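/- **Setting.** Let $d_1=\tfrac12(1,-\sqrt3)$, $d_2=\tfrac12(1,\sqrt3)$, $d_3=(-1,0)$, $a_1=d_2-d_3$, $a_2=d_3-d_1$, $a_3=d_1-d_2$, let $\Gamma=\mathrm{Span}_{\mathbb Z}\{a_1,a_2,a_3\}$, let $\mathcal C=\Gamma\cup(\Gamma+d_3)\subset\mathbb R^2$ be the honeycomb structure, and let $\mathcal H=\ell^2(\mathcal C)\otimes\mathbb C^2$. Let $\sigma_x,\sigma_y,\sigma_z$ be the Pauli matrices, acting on the spin factor $\mathbb C^2$, and let $S_z=\tfrac12\,\mathbb 1\otimes\sigma_z$. Let $X_i$ ($i=1,2$) be the position operator $(X_i\psi)(x)=x_i\psi(x)$ on its maximal domain. A bounded operator $A$ on $\mathcal H$ is *periodic* if it commutes with all translations by vectors of $\Gamma$. It is *short-range* if there are $C,\xi>0$ with $|A_{n,m}|\le C e^{-|n-m|_1/\xi}$ for all $n,m\in\mathbb Z^2$, where $A_{n,m}$ is the $4\times4$ block of matrix elements between the cells $\{\gamma_n,\gamma_n+d_3\}$ and $\{\gamma_m,\gamma_m+d_3\}$, with $\gamma_n=n_1a_1+n_2a_2$.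 The class $\mathrm{AII}^{\hexagon}$ consists of the bounded periodic operators $H$ that commute with the rotation $(R_{2\pi/3}\psi)(x)=e^{-i\frac{2\pi}{3}S_z}\psi(\mathrm R_{2\pi/3}^{-1}x)$ (where $\mathrm R_{2\pi/3}$ is the counterclockwise rotation of the plane by $2\pi/3$), with the reflection $(R_{\mathrm v\otimes \mathrm h}\psi)(x_1,x_2)=-i\sigma_y\psi(x_1,-x_2)$ and with the time reversal $(\Theta\psi)(x)=i\sigma_y\overline{\psi(x)}$, and that do not anticommute with $(\Xi\psi)(x)=\sigma_x\overline{\psi(x)}$. For odd $L$ let $C_L=\{x\in\mathcal C: x=\alpha_1a_1+\alpha_2a_2,\ |\alpha_1|,|\alpha_2|\le L/2\}$ and let $\chi_L$ be the multiplication operator by its characteristic function. The trace per unit volume of a (possibly unbounded) operator $A$ on $\mathcal H$ is $$\tau(A)=\lim_{L\to\infty,\ L\ \mathrm{odd}}\frac1{|C_L|}\mathrm{Tr}(\chi_LA\chi_L),$$ well-defined if every $\chi_LA\chi_L$ is defined on all of $\mathcal H$ and the limit exists. An *insulator* $(H,\mu)$ is a bounded self-adjoint operator $H$ together with $\mu\in\mathbb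 R$ lying in a gap of its spectrum (that is, $\mu\notin\sigma(H)$). Its Fermi projection is $P=\chi_{(-\infty,\mu]}(H)$. For $\eta>0$ put $$L_{\eta,j}=i\int_{-\infty}^0 e^{\eta s}\,e^{isH}[X_j,P]e^{-isH}\,ds,\qquad P_1=\lim_{\eta\to0^+}L_{\eta,j}\ \text{ (in operator norm)}.$$ The conventional and the proper spin current operators are $$J_i^{\mathrm{conv}}=\tfrac i2[H,X_i]S_z+\tfrac i2S_z[H,X_i],\qquad J_i^{\mathrm{prop}}=i[H,X_iS_z],$$ the latter being unbounded, on its natural domain. Commutators of a bounded operator with $X_i$, other than in $J_i^{\mathrm{prop}}$, denote their bounded extensions to $\mathcal H$. For $\sharp\in\{\mathrm{conv},\mathrm{prop}\}$ the spin conductivity is $\sigma^{\mathrm s,\sharp}_{ij}=\lim_{\eta\to0^+}\mathrm{Re}\,\tau(J_i^\sharp L_{\eta,j})$; it is well-defined if $\tau(J_i^\sharp L_{\eta,j})$ is well-defined for all $\eta>0$ and the limit exists. **Proposition.** Let $(H,\mu)$ be an insulator with $H$ short-range and in the class $\mathrm{AII}^{\hexagon}$, and let $i,j\in\{1,2\}$.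 Then the commutators of $H$, $P$ and $[P,S_z]$ with the position operators that occur here are densely defined and extend to bounded operators, the limit $P_1$ exists and is periodic, and the following holds. (i) Both spin conductivities are well-defined, and $\sigma^{\mathrm s,\mathrm{prop}}_{ij}=\sigma^{\mathrm s,\mathrm{conv}}_{ij}$. (ii) $\sigma^{\mathrm s,\mathrm{conv}}_{ij}=\Sigma^{\mathrm{sc}}_{ij}+\Sigma^{\mathrm{snc}}_{ij}$, where $$\Sigma^{\mathrm{sc}}_{ij}=\mathrm{Re}\,\tau\Big(iS_zP\big[[X_i,P],[X_j,P]\big]\Big),$$ $$\Sigma^{\mathrm{snc}}_{ij}=\mathrm{Re}\,\tau\Big(i[H,X_i]\big[[S_z,P],P\big]P_1+i\big[[X_i,P],P\big][S_z,H]P_1+iP[X_i,P]\big[[P,S_z],X_j\big]\Big),$$ and both traces per unit volume are well-defined. (iii) In particular, if $[H,S_z]=0$, then $\sigma^{\mathrm s,\mathrm{conv}}_{ij}=\Sigma^{\mathrm{sc}}_{ij}$. -/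

import Mathlib

open Filter Topology

namespace SpinHall

noncomputable section

/-! ### The honeycomb structure -/

/-- Nearest-neighbour vectors `d₁, d₂, d₃` of the honeycomb structure (indexed by `0, 1, 2`). -/
def nnVec : Fin 3 → Fin 2 → ℝ :=
  ![![1 / 2, -(√3 / 2)], ![1 / 2, √3 / 2], ![-1, 0]]

/-- Next-to-nearest-neighbour vectors `a₁ = d₂ - d₃`, `a₂ = d₃ - d₁`, `a₃ = d₁ - d₂`. -/
def nnnVec : Fin 3 → Fin 2 → ℝ :=
  ![nnVec 1 - nnVec 2, nnVec 2 - nnVec 0, nnVec 0 - nnVec 1]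

/-- The Bravais lattice `Γ = Span_ℤ {a₁, a₂, a₃}`. -/
def bravais : AddSubgroup (Fin 2 → ℝ) := AddSubgroup.closure (Set.range nnnVec)

/-- The honeycomb structure `𝒞 = Γ ∪ (Γ + d₃)` as a subset of the plane. -/
def honeycomb : Set (Fin 2 → ℝ) := {x | x ∈ bravais ∨ x - nnVec 2 ∈ bravais}

/-- Sites of the honeycomb structure in the dimerization with respect to `d₃`: `((n₁, n₂), 0)` is
the `A`-site `n₁ a₁ + n₂ a₂` and `((n₁, n₂), 1)` is the `B`-site `n₁ a₁ + n₂ a₂ + d₃`;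
see `pos`, `pos_injective` and `range_pos`. -/
abbrev Site : Type := (ℤ × ℤ) × Fin 2

/-- Spin index: `0` is up and `1` is down. -/
abbrev Spin : Type := Fin 2

/-- The point of the Bravais lattice with coordinates `n` in the basis `a₁, a₂`. -/
def latticePt (n : ℤ × ℤ) : Fin 2 → ℝ := (n.1 : ℝ) • nnnVec 0 + (n.2 : ℝ) • nnnVec 1

/-- The position in the plane of a site. -/
def pos (x : Site) : Fin 2 → ℝ := latticePt x.1 + ((x.2 : ℕ) : ℝ) • nnVec 2

lemma pos_zero (x : Site) :
    pos x 0 = 3 / 2 * ((x.1.1 : ℝ) - x.1.2) - ((x.2 : ℕ) : ℝ) := by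
  simp [pos, latticePt, nnnVec, nnVec]; ring

lemma pos_one (x : Site) : pos x 1 = √3 / 2 * ((x.1.1 : ℝ) + x.1.2) := by
  simp [pos, latticePt, nnnVec, nnVec]; ring

lemma pos_injective : Function.Injective pos := by
  rintro ⟨⟨a, b⟩, s⟩ ⟨⟨c, d⟩, t⟩ h
  have h0 := congrFun h 0
  have h1 := congrFun h 1
  simp only [pos_zero, pos_one] at h0 h1
  have h3 : (√3 / 2 : ℝ) ≠ 0 := by positivity
  have h1' := mul_left_cancel₀ h3 h1
  have e1 : a + b = c + d := by exact_mod_cast h1'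
  have e0 : 3 * (a - b) - 2 * ((s : ℕ) : ℤ) = 3 * (c - d) - 2 * ((t : ℕ) : ℤ) := by
    have : 3 * ((a : ℝ) - b) - 2 * ((s : ℕ) : ℝ) = 3 * ((c : ℝ) - d) - 2 * ((t : ℕ) : ℝ) := by
      linarith
    exact_mod_cast this
  have hs := s.2
  have ht := t.2
  have hst : (s : ℕ) = (t : ℕ) := by omega
  have : s = t := Fin.ext hst
  subst this
  have ha : a = c := by omega
  have hb : b = d := by omega
  subst ha hb
  rfl

lemma mem_bravais_iff (x : Fin 2 → ℝ) : x ∈ bravais ↔ ∃ n : ℤ × ℤ, latticePt n = x := by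
  constructor
  · intro hx
    induction hx using AddSubgroup.closure_induction with
    | mem x hx =>
      obtain ⟨k, rfl⟩ := hx
      fin_cases k
      · exact ⟨(1, 0), by simp [latticePt]⟩
      · exact ⟨(0, 1), by simp [latticePt]⟩
      · exact ⟨(-1, -1), by ext i; simp [latticePt, nnnVec]⟩
    | zero => exact ⟨(0, 0), by simp [latticePt]⟩
    | add x y _ _ hx hy =>
      obtain ⟨n, rfl⟩ := hx
      obtain ⟨m, rfl⟩ := hy
      exact ⟨n + m, by ext i; simp [latticePt]; ring⟩
    | neg x _ hx =>
      obtain ⟨n, rfl⟩ := hx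
      exact ⟨-n, by ext i; simp [latticePt]; ring⟩
  · rintro ⟨n, rfl⟩
    unfold latticePt
    rw [Int.cast_smul_eq_zsmul, Int.cast_smul_eq_zsmul]
    exact add_mem (zsmul_mem (AddSubgroup.subset_closure (Set.mem_range_self 0)) _)
      (zsmul_mem (AddSubgroup.subset_closure (Set.mem_range_self 1)) _)

/-- The sites are exactly the points of the honeycomb structure. -/
lemma range_pos : Set.range pos = honeycomb := by
  ext x
  simp only [Set.mem_range, honeycomb, Set.mem_ofPred_eq, mem_bravais_iff]
  constructor
  · rintro ⟨⟨n, s⟩, rfl⟩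
    fin_cases s
    · exact Or.inl ⟨n, by simp [pos]⟩
    · exact Or.inr ⟨n, by simp [pos]⟩
  · rintro (⟨n, rfl⟩ | ⟨n, h⟩)
    · exact ⟨(n, 0), by simp [pos]⟩
    · exact ⟨(n, 1), by simp [pos, h]⟩

/-- Translation of the sites by a vector of the Bravais lattice. -/
def translateSite (n : ℤ × ℤ) : Site ≃ Site where
  toFun x := (x.1 + n, x.2)
  invFun x := (x.1 - n, x.2)
  left_inv x := by simp
  right_inv x := by simp

lemma pos_translateSite (n : ℤ × ℤ) (x : Site) :
    pos (translateSite n x) = pos x + latticePt n := by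
  ext i; simp [pos, latticePt, translateSite]; ring

/-- Counterclockwise rotation of the plane by `2π/3`. -/
def rotVec (x : Fin 2 → ℝ) : Fin 2 → ℝ :=
  ![-(1 / 2) * x 0 - √3 / 2 * x 1, √3 / 2 * x 0 - 1 / 2 * x 1]

/-- Vertical reflection of the plane. -/
def reflVec (x : Fin 2 → ℝ) : Fin 2 → ℝ := ![x 0, -x 1]

/-- The rotation by `2π/3` restricted to the honeycomb structure; see `pos_rotSite`. -/
def rotSite : Site ≃ Site where
  toFun x := ((-x.1.2, x.1.1 - x.1.2 - ((x.2 : ℕ) : ℤ)), x.2)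
  invFun x := ((x.1.2 - x.1.1 + ((x.2 : ℕ) : ℤ), -x.1.1), x.2)
  left_inv x := by ext <;> (simp; try ring)
  right_inv x := by ext <;> (simp; try ring)

lemma pos_rotSite (x : Site) : pos (rotSite x) = rotVec (pos x) := by
  have h3 : √3 * √3 = (3 : ℝ) := Real.mul_self_sqrt (by norm_num)
  ext i
  fin_cases i
  · simp [rotVec, pos_zero, pos_one, rotSite]
    linear_combination (1 / 4 * ((x.1.1 : ℝ) + x.1.2)) * h3
  · simp [rotVec, pos_zero, pos_one, rotSite]
    ring

/-- The vertical reflection restricted to the honeycomb structure; see `pos_reflSite`. -/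
def reflSite : Site ≃ Site where
  toFun x := ((-x.1.2, -x.1.1), x.2)
  invFun x := ((-x.1.2, -x.1.1), x.2)
  left_inv x := by ext <;> simp
  right_inv x := by ext <;> simp

lemma pos_reflSite (x : Site) : pos (reflSite x) = reflVec (pos x) := by
  ext i
  fin_cases i
  · simp [reflVec, pos_zero, reflSite]; ring
  · simp [reflVec, pos_one, reflSite]; ring

/-! ### The Hilbert space and its bounded operators -/

/-- The Hilbert space `ℓ²(𝒞) ⊗ ℂ²`, realized as `ℓ²(𝒞 × {↑, ↓})` with its usual inner product. -/
def Hil : Type := lp (fun _ : Site × Spin => ℂ) 2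

instance : NormedAddCommGroup Hil :=
  inferInstanceAs (NormedAddCommGroup (lp (fun _ : Site × Spin => ℂ) 2))

instance : InnerProductSpace ℂ Hil :=
  inferInstanceAs (InnerProductSpace ℂ (lp (fun _ : Site × Spin => ℂ) 2))

instance : CompleteSpace Hil :=
  inferInstanceAs (CompleteSpace (lp (fun _ : Site × Spin => ℂ) 2))

/-- The value `ψ(x)_s` of an element of the Hilbert space. -/
def Hil.val (ψ : Hil) : Site × Spin → ℂ :=
  Subtype.val (p := fun f : PreLp fun _ : Site × Spin => ℂ => f ∈ lp (fun _ => ℂ) 2) ψ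

instance : CoeFun Hil fun _ => Site × Spin → ℂ := ⟨Hil.val⟩

/-- The element of the Hilbert space with given square-summable values. -/
def Hil.mk (f : Site × Spin → ℂ) (hf : Memℓp f 2) : Hil :=
  (⟨f, hf⟩ : lp (fun _ : Site × Spin => ℂ) 2)

lemma Hil.memlp (ψ : Hil) : Memℓp (fun p => ψ p) 2 :=
  lp.memℓp (E := fun _ : Site × Spin => ℂ) (p := 2) ψ

@[simp] lemma Hil.mk_apply (f : Site × Spin → ℂ) (hf : Memℓp f 2) (p : Site × Spin) :
    Hil.mk f hf p = f p := rfl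

@[simp] lemma Hil.add_apply (ψ φ : Hil) (p : Site × Spin) : (ψ + φ) p = ψ p + φ p := rfl

@[simp] lemma Hil.smul_apply (c : ℂ) (ψ : Hil) (p : Site × Spin) : (c • ψ) p = c * ψ p := rfl

@[simp] lemma Hil.sub_apply (ψ φ : Hil) (p : Site × Spin) : (ψ - φ) p = ψ p - φ p := rfl

@[simp] lemma Hil.zero_apply (p : Site × Spin) : (0 : Hil) p = 0 := rfl

lemma Hil.ext {ψ φ : Hil} (h : ∀ p, ψ p = φ p) : ψ = φ := Subtype.ext (funext h)

lemma Hil.norm_apply_le (ψ : Hil) (p : Site × Spin) : ‖ψ p‖ ≤ ‖ψ‖ :=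
  lp.norm_apply_le_norm (E := fun _ : Site × Spin => ℂ) (p := 2) (by norm_num) ψ p

/-- The inner product, antilinear in the first argument. -/
lemma Hil.inner_eq (ψ φ : Hil) : inner ℂ ψ φ = ∑' p, inner ℂ (ψ p) (φ p) :=
  lp.inner_eq_tsum (𝕜 := ℂ) (G := fun _ : Site × Spin => ℂ) ψ φ

/-- Bounded operators, with the operator norm. -/
abbrev Op : Type := Hil →L[ℂ] Hil

/-- The canonical orthonormal basis. -/
def delta (p : Site × Spin) : Hil := lp.single (E := fun _ : Site × Spin => ℂ) 2 p 1

lemma delta_apply (p q : Site × Spin) : delta p q = if q = p then 1 else 0 := by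
  change (Pi.single p (1 : ℂ) : Site × Spin → ℂ) q = _
  rw [Pi.single_apply]

lemma memlp_spin (g : Site ≃ Site) (M : Matrix Spin Spin ℂ) (ψ : Hil) :
    Memℓp (fun p : Site × Spin => ∑ s, M p.2 s * ψ (g.symm p.1, s)) 2 := by
  have hp : (0 : ℝ) < (2 : ENNReal).toReal := by norm_num
  have hψ : Summable fun p : Site × Spin => ‖ψ p‖ ^ (2 : ENNReal).toReal :=
    (memℓp_gen_iff hp).1 ψ.memlp
  have key : ∀ s : Spin, Memℓp (fun p : Site × Spin => M p.2 s * ψ (g.symm p.1, s)) 2 := by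
    intro s
    have h1 : ∀ t : Spin,
        Summable fun x : Site => ‖M t s * ψ (g.symm x, s)‖ ^ (2 : ENNReal).toReal := by
      intro t
      have h2 : Summable fun x : Site => ‖ψ (x, s)‖ ^ (2 : ENNReal).toReal :=
        hψ.comp_injective (i := fun x : Site => (x, s)) fun x y h => (Prod.mk.inj h).1
      have h3 := ((Equiv.summable_iff g.symm).2 h2).mul_left (‖M t s‖ ^ (2 : ENNReal).toReal)
      refine h3.congr fun x => ?_
      simp [mul_pow]
    refine (memℓp_gen_iff hp).2 ?_
    have h4 := (summable_prod_of_nonneg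
      (f := fun q : Spin × Site => ‖M q.1 s * ψ (g.symm q.2, s)‖ ^ (2 : ENNReal).toReal)
      (fun q => by positivity)).2 ⟨h1, (hasSum_fintype _).summable⟩
    exact (Equiv.summable_iff (Equiv.prodComm Site Spin)).2 h4
  have h5 : (fun p : Site × Spin => ∑ s, M p.2 s * ψ (g.symm p.1, s)) =
      fun p => ∑ s ∈ Finset.univ, (fun s (p : Site × Spin) => M p.2 s * ψ (g.symm p.1, s)) s p :=
    rfl
  rw [h5]
  exact Memℓp.finsetSum _ fun s _ => key s

/-- The linear map underlying `spinOp`. -/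
def spinLin (g : Site ≃ Site) (M : Matrix Spin Spin ℂ) : Hil →ₗ[ℂ] Hil where
  toFun ψ := Hil.mk (fun p => ∑ s, M p.2 s * ψ (g.symm p.1, s)) (memlp_spin g M ψ)
  map_add' ψ φ := by
    refine Hil.ext fun p => ?_
    simp [mul_add]
    ring
  map_smul' c ψ := by
    refine Hil.ext fun p => ?_
    simp
    ring

/-- The operator `(U ψ)(x) = M ψ(g⁻¹ x)`, for a bijection `g` of the honeycomb structure and a
matrix `M` acting on the spin. -/
def spinOp (g : Site ≃ Site) (M : Matrix Spin Spin ℂ) : Op :=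
  ContinuousLinearMap.ofSeqClosedGraph (g := spinLin g M) (by
    intro u x y hu hy
    have hc : ∀ (v : ℕ → Hil) (z : Hil), Tendsto v atTop (𝓝 z) →
        ∀ p, Tendsto (fun n => v n p) atTop (𝓝 (z p)) := by
      intro v z hv p
      rw [tendsto_iff_norm_sub_tendsto_zero] at hv ⊢
      refine squeeze_zero (fun _ => norm_nonneg _) (fun n => ?_) hv
      exact Hil.norm_apply_le (v n - z) p
    refine Hil.ext fun p => ?_
    refine tendsto_nhds_unique (hc _ _ hy p) ?_
    change Tendsto (fun n => ∑ s, M p.2 s * u n (g.symm p.1, s)) atTop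
      (𝓝 (∑ s, M p.2 s * x (g.symm p.1, s)))
    exact tendsto_finsetSum _ fun s _ => (hc u x hu _).const_mul _)

lemma spinOp_apply (g : Site ≃ Site) (M : Matrix Spin Spin ℂ) (ψ : Hil) (p : Site × Spin) :
    spinOp g M ψ p = ∑ s, M p.2 s * ψ (g.symm p.1, s) := rfl

/-- Pauli matrix `σ_x`. -/
def sigmaX : Matrix Spin Spin ℂ := !![0, 1; 1, 0]

/-- Pauli matrix `σ_y`. -/
def sigmaY : Matrix Spin Spin ℂ := !![0, -Complex.I; Complex.I, 0]

/-- Pauli matrix `σ_z`. -/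
def sigmaZ : Matrix Spin Spin ℂ := !![1, 0; 0, -1]

/-- The spin operator `S_z = ½ 1 ⊗ σ_z`. -/
def Sz : Op := spinOp (Equiv.refl Site) ((1 / 2 : ℂ) • sigmaZ)

/-- Translation operators by the vectors of the Bravais lattice. -/
def translation (n : ℤ × ℤ) : Op := spinOp (translateSite n) 1

/-- The `2π/3`-rotation operator `(R ψ)(x) = exp(-i (2π/3) S_z) ψ(R⁻¹ x)`. -/
def rotation : Op :=
  spinOp rotSite
    (NormedSpace.exp ((-Complex.I * (2 * Real.pi / 3 : ℝ)) • ((1 / 2 : ℂ) • sigmaZ)))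

/-- The spatial-vertical and spin-horizontal reflection `(R ψ)(x) = -i σ_y ψ(R_v⁻¹ x)`. -/
def reflection : Op := spinOp reflSite ((-Complex.I) • sigmaY)

/-- Complex conjugation of the components. -/
def conjHil (ψ : Hil) : Hil := Hil.mk (fun p => star (ψ p)) ψ.memlp.star_mem

/-- Time reversal `(Θ ψ)(x) = i σ_y conj (ψ x)`. -/
def timeReversal (ψ : Hil) : Hil := spinOp (Equiv.refl Site) (Complex.I • sigmaY) (conjHil ψ)

/-- Particle-hole operator `(Ξ ψ)(x) = σ_x conj (ψ x)`. -/
def particleHole (ψ : Hil) : Hil := spinOp (Equiv.refl Site) sigmaX (conjHil ψ)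

/-- `A` is `Γ`-periodic. -/
def IsPeriodic (A : Op) : Prop := ∀ n : ℤ × ℤ, A * translation n = translation n * A

/-- `A` is short-range: the `4 × 4` blocks `A_{n,m}`, `n, m ∈ ℤ²`, in the dimerization with respect
to `d₃` decay exponentially in `|n - m|₁`. (The matrix norm of a block is estimated through its
sixteen entries.) -/
def IsShortRange (A : Op) : Prop :=
  ∃ C ξ : ℝ, 0 < C ∧ 0 < ξ ∧ ∀ (n m : ℤ × ℤ) (a b : Fin 2) (s t : Spin),
    ‖A (delta ((m, b), t)) ((n, a), s)‖ ≤
      C * Real.exp (-((|n.1 - m.1| + |n.2 - m.2| : ℤ) : ℝ) / ξ)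

/-- The class `AII^hexagon`. -/
structure IsAIIHex (H : Op) : Prop where
  periodic : IsPeriodic H
  rotation_symm : H * rotation = rotation * H
  reflection_symm : H * reflection = reflection * H
  timeReversal_symm : ∀ ψ, H (timeReversal ψ) = timeReversal (H ψ)
  not_particleHole : ¬ ∀ ψ, H (particleHole ψ) + particleHole (H ψ) = 0

/-- `(H, μ)` is an insulator: `H` is self-adjoint and `μ` lies in a gap of its spectrum. -/
def IsInsulator (H : Op) (μ : ℝ) : Prop := IsSelfAdjoint H ∧ μ ∉ spectrum ℝ H

/-- The Fermi projection `χ_{(-∞, μ]}(H)`. (The indicator function is continuous on the spectrum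
when `μ` lies in a gap, so that the continuous functional calculus applies.) -/
def fermiProj (H : Op) (μ : ℝ) : Op := cfc (Set.indicator (Set.Iic μ) fun _ : ℝ => (1 : ℝ)) H

/-! ### Unbounded operators -/

/-- Possibly unbounded operators, each with its own domain. -/
abbrev UOp : Type := Hil →ₗ.[ℂ] Hil

/-- A bounded operator as an operator defined everywhere. -/
def toU (A : Op) : UOp := LinearMap.toPMap (A : Hil →ₗ[ℂ] Hil) ⊤

/-- The product `A B` on its natural domain `{ψ ∈ D(B) | B ψ ∈ D(A)}`. -/
def prodU (A B : UOp) : UOp where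
  domain := (A.domain.comap B.toFun).map B.domain.subtype
  toFun :=
    { toFun := fun ψ => A ⟨B ⟨ψ, by
          obtain ⟨x, _, hx⟩ := ψ.2
          exact hx ▸ x.2⟩, by
          obtain ⟨x, hx, hx'⟩ := ψ.2
          have hx : B x ∈ A.domain := hx
          have : x = ⟨(ψ : Hil), hx' ▸ x.2⟩ := Subtype.ext hx'
          exact this ▸ hx⟩
      map_add' := fun ψ φ => by
        rw [← LinearPMap.map_add]
        congr 1
        apply Subtype.ext
        change B _ = B _ + B _
        rw [← LinearPMap.map_add]
        rfl
      map_smul' := fun c ψ => by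
        rw [RingHom.id_apply, ← LinearPMap.map_smul]
        congr 1
        apply Subtype.ext
        change B _ = c • B _
        rw [← LinearPMap.map_smul]
        rfl }

lemma mem_prodU_domain (A B : UOp) (ψ : Hil) :
    ψ ∈ (prodU A B).domain ↔ ∃ h : ψ ∈ B.domain, B ⟨ψ, h⟩ ∈ A.domain := by
  constructor
  · rintro ⟨x, hx, rfl⟩
    exact ⟨x.2, hx⟩
  · rintro ⟨h, h'⟩
    exact ⟨⟨ψ, h⟩, h', rfl⟩

lemma prodU_apply (A B : UOp) (ψ : Hil) (h : ψ ∈ (prodU A B).domain) (hB : ψ ∈ B.domain)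
    (hA : B ⟨ψ, hB⟩ ∈ A.domain) : prodU A B ⟨ψ, h⟩ = A ⟨B ⟨ψ, hB⟩, hA⟩ := rfl

/-- The commutator `A B - B A` on its natural domain. -/
def commU (A B : UOp) : UOp := prodU A B - prodU B A

/-- `B` is the bounded extension of the densely defined operator `T`. -/
def IsBoundedExtension (T : UOp) (B : Op) : Prop :=
  Dense (T.domain : Set Hil) ∧ ∀ ψ : T.domain, T ψ = B ψ

open Classical in
/-- The bounded operator on the whole space that extends the densely defined operator `T`
(and `0` if there is none). -/
def extend (T : UOp) : Op := if h : ∃ B, IsBoundedExtension T B then h.choose else 0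

/-- The position operator `X_i` on its maximal domain. -/
def X (i : Fin 2) : UOp where
  domain :=
    { carrier := {ψ : Hil | Memℓp (fun p : Site × Spin => (pos p.1 i : ℂ) * ψ p) 2}
      add_mem' := fun {ψ φ} h h' => by
        have := Memℓp.add h h'
        refine (congrArg (Memℓp · 2) ?_).mp this
        ext p
        simp [mul_add]
      zero_mem' := by
        have : (fun p : Site × Spin => (pos p.1 i : ℂ) * (0 : Hil) p) = 0 := by
          ext p
          simp
        exact (congrArg (Memℓp · 2) this).mpr zero_memℓp
      smul_mem' := fun c ψ h => by
        have := Memℓp.const_smul h c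
        refine (congrArg (Memℓp · 2) ?_).mp this
        ext p
        simp
        ring }
  toFun :=
    { toFun := fun ψ => Hil.mk (fun p => (pos p.1 i : ℂ) * (ψ : Hil) p) ψ.2
      map_add' := fun ψ φ => by
        refine Hil.ext fun p => ?_
        simp [mul_add]
      map_smul' := fun c ψ => by
        refine Hil.ext fun p => ?_
        simp
        ring }

/-- The bounded operator `[A, X_i]`. -/
def commAX (A : Op) (i : Fin 2) : Op := extend (commU (toU A) (X i))

/-- The bounded operator `[X_i, A]`. -/
def commXA (i : Fin 2) (A : Op) : Op := extend (commU (X i) (toU A))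

/-- The commutator `[A, B] = A B - B A` of bounded operators. -/
def commOp (A B : Op) : Op := A * B - B * A

/-! ### Trace per unit volume -/

/-- The sites of the fundamental cell of side `2 k + 1`; see `mem_cell_iff`. -/
def cell (k : ℕ) : Finset Site :=
  (Finset.Icc (-k : ℤ) k ×ˢ Finset.Icc (-k : ℤ) k) ×ˢ Finset.univ

/-- The fundamental cell of side `L = 2 k + 1` consists of the points `α₁ a₁ + α₂ a₂` of the
honeycomb structure with `|α₁|, |α₂| ≤ L / 2`. -/
lemma mem_cell_iff (k : ℕ) (x : Site) :
    x ∈ cell k ↔ ∃ α β : ℝ, |α| ≤ ((2 * k + 1 : ℕ) : ℝ) / 2 ∧ |β| ≤ ((2 * k + 1 : ℕ) : ℝ) / 2 ∧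
      pos x = α • nnnVec 0 + β • nnnVec 1 := by
  obtain ⟨⟨a, b⟩, s⟩ := x
  have e1 : ∀ α β : ℝ, (α • nnnVec 0 + β • nnnVec 1) 0 = 3 / 2 * (α - β) := by
    intro α β; simp [nnnVec, nnVec]; ring
  have e2 : ∀ α β : ℝ, (α • nnnVec 0 + β • nnnVec 1) 1 = √3 / 2 * (α + β) := by
    intro α β; simp [nnnVec, nnVec]; ring
  simp only [cell, Finset.mem_product, Finset.mem_Icc, Finset.mem_univ, and_true]
  constructor
  · rintro ⟨⟨h1, h2⟩, h3, h4⟩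
    have h1' : (-k : ℝ) ≤ a := by exact_mod_cast h1
    have h2' : (a : ℝ) ≤ k := by exact_mod_cast h2
    have h3' : (-k : ℝ) ≤ b := by exact_mod_cast h3
    have h4' : (b : ℝ) ≤ k := by exact_mod_cast h4
    have hs : ((s : ℕ) : ℝ) ≤ 1 := by exact_mod_cast Nat.lt_succ_iff.1 s.2
    have hs0 : (0 : ℝ) ≤ ((s : ℕ) : ℝ) := by positivity
    refine ⟨a - ((s : ℕ) : ℝ) / 3, b + ((s : ℕ) : ℝ) / 3, ?_, ?_, ?_⟩
    · rw [abs_le]; push_cast; constructor <;> linarith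
    · rw [abs_le]; push_cast; constructor <;> linarith
    · ext i
      fin_cases i
      · refine Eq.trans (pos_zero _) (Eq.trans ?_ (e1 _ _).symm)
        dsimp only; ring
      · refine Eq.trans (pos_one _) (Eq.trans ?_ (e2 _ _).symm)
        dsimp only; ring
  · rintro ⟨α, β, hα, hβ, h⟩
    have h0 := congrFun h 0
    have h1 := congrFun h 1
    rw [pos_zero, e1] at h0
    rw [pos_one, e2] at h1
    have h3 : (√3 / 2 : ℝ) ≠ 0 := by positivity
    have h1' := mul_left_cancel₀ h3 h1
    dsimp only at h0 h1'
    rw [abs_le] at hα hβ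
    push_cast at hα hβ
    have hs : ((s : ℕ) : ℝ) ≤ 1 := by exact_mod_cast Nat.lt_succ_iff.1 s.2
    have hs0 : (0 : ℝ) ≤ ((s : ℕ) : ℝ) := by positivity
    have ha : (a : ℝ) = α + ((s : ℕ) : ℝ) / 3 := by linarith
    have hb : (b : ℝ) = β - ((s : ℕ) : ℝ) / 3 := by linarith
    have k1 : (-k : ℝ) - 1 < a := by linarith
    have k2 : (a : ℝ) < k + 1 := by linarith
    have k3 : (-k : ℝ) - 1 < b := by linarith
    have k4 : (b : ℝ) < k + 1 := by linarith
    have k1' : (-k : ℤ) - 1 < a := by exact_mod_cast k1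
    have k2' : a < (k : ℤ) + 1 := by exact_mod_cast k2
    have k3' : (-k : ℤ) - 1 < b := by exact_mod_cast k3
    have k4' : b < (k : ℤ) + 1 := by exact_mod_cast k4
    omega

/-- `A` has trace per unit volume `t`: for every odd `L` the finite-rank operator `χ_L A χ_L` is
defined everywhere, that is, the basis vectors supported in the cell `C_L` lie in the domain
of `A`, and `|C_L|⁻¹ Tr (χ_L A χ_L)` tends to `t`. The trace is computed in the canonical
orthonormal basis, to which only basis vectors supported in `C_L` contribute. -/
def HasTracePUV (A : UOp) (t : ℂ) : Prop :=
  ∃ h : ∀ p, delta p ∈ A.domain,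
    Tendsto (fun k : ℕ => ((cell k).card : ℂ)⁻¹ *
      ∑ p ∈ cell k ×ˢ (Finset.univ : Finset Spin), inner ℂ (delta p) (A ⟨delta p, h p⟩))
      atTop (𝓝 t)

/-- The trace per unit volume of `A` is well-defined. -/
def TracePUVExists (A : UOp) : Prop := ∃ t, HasTracePUV A t

open Classical in
/-- The trace per unit volume `τ(A)` (and `0` if it is not well-defined). -/
def tau (A : UOp) : ℂ := if h : TracePUVExists A then h.choose else 0

/-! ### Linear response and spin conductivities -/

/-- The linear response
`L_{η,j} = i ∫_{-∞}^0 e^{ηs} e^{isH} [X_j, P] e^{-isH} ds` of the Fermi projection. -/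
def linResponse (H : Op) (μ : ℝ) (j : Fin 2) (η : ℝ) : Op :=
  Complex.I • ∫ s in Set.Iic (0 : ℝ), (Real.exp (η * s) : ℂ) •
    (NormedSpace.exp ((Complex.I * (s : ℂ)) • H) * commXA j (fermiProj H μ) *
      NormedSpace.exp ((-(Complex.I * (s : ℂ))) • H))

/-- `P₁ = lim_{η → 0⁺} L_{η,j}`, in operator norm. -/
def P1 (H : Op) (μ : ℝ) (j : Fin 2) : Op := limUnder (𝓝[>] (0 : ℝ)) (linResponse H μ j)

/-- The conventional spin current `(i/2) [H, X_i] S_z + (i/2) S_z [H, X_i]`. -/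
def Jconv (H : Op) (i : Fin 2) : UOp :=
  toU ((Complex.I / 2) • (commAX H i * Sz) + (Complex.I / 2) • (Sz * commAX H i))

/-- The proper spin current `i [H, X_i S_z]`, an unbounded operator on its natural domain. -/
def Jprop (H : Op) (i : Fin 2) : UOp := Complex.I • commU (toU H) (prodU (X i) (toU Sz))

/-- The spin conductivity of the spin current `J` is well-defined with value `σ`: the trace per unit
volume `τ(J L_{η,j})` exists for all `η > 0`, and `Re τ(J L_{η,j}) → σ` as `η → 0⁺`. -/
def IsSpinConductivity (J : UOp) (H : Op) (μ : ℝ) (j : Fin 2) (σ : ℝ) : Prop :=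
  (∀ η : ℝ, 0 < η → TracePUVExists (prodU J (toU (linResponse H μ j η)))) ∧
    Tendsto (fun η : ℝ => (tau (prodU J (toU (linResponse H μ j η)))).re) (𝓝[>] 0) (𝓝 σ)

/-- The operator `i S_z P [[X_i, P], [X_j, P]]`. -/
def scOp (H : Op) (μ : ℝ) (i j : Fin 2) : Op :=
  let P := fermiProj H μ
  Complex.I • (Sz * P * commOp (commXA i P) (commXA j P))

/-- The operator `i [H, X_i] [[S_z, P], P] P₁ + i [[X_i, P], P] [S_z, H] P₁
+ i P [X_i, P] [[P, S_z], X_j]`. -/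
def sncOp (H : Op) (μ : ℝ) (i j : Fin 2) : Op :=
  let P := fermiProj H μ
  Complex.I • (commAX H i * commOp (commOp Sz P) P * P1 H μ j) +
    Complex.I • (commOp (commXA i P) P * commOp Sz H * P1 H μ j) +
    Complex.I • (P * commXA i P * commAX (commOp P Sz) j)

/-- The spin-commuting term. -/
def sigmaSC (H : Op) (μ : ℝ) (i j : Fin 2) : ℝ := (tau (toU (scOp H μ i j))).re

/-- The spin-noncommuting term. -/
def sigmaSNC (H : Op) (μ : ℝ) (i j : Fin 2) : ℝ := (tau (toU (sncOp H μ i j))).re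

end

end SpinHall

open SpinHall

namespace SpinHall

noncomputable section

/-! ### Matrix elements of bounded operators -/

/-! The proof rests on one analytic estimate, one symmetry argument and one algebraic identity.

Estimate. Call `Q` off-diagonal if `Q P + P Q = Q`. Since `μ` lies in a gap, an off-diagonal
operator is bounded in norm by its commutator with `H` (`exists_norm_corner_le`,
`exists_norm_le_of_offDiag`). Short range makes the commutators of `H` with truncated coordinates
bounded uniformly in the truncation. The estimate transfers this to `P` and to `[X_j, P]`, so no
decay of the kernel of `P` is needed. It also shows that the responses `L_{η,j}` to the off-diagonal
source `[X_j, P]` are Cauchy as `η → 0`. The limit `P₁` is off-diagonal and solves `[H, P₁] = [X_j,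
P]`.

Symmetry. On the domain of `X_i` the proper current is `i [H, X_i] S_z + i X_i [H, S_z]`. The
operators `[H, S_z] L_{η,j}`, `j = 1, 2`, form a vector under the rotation by `2π/3`, which fixes no
nonzero vector of the plane. Hence their spin trace vanishes at every site, and the unbounded term
drops out of every finite-volume trace (`spinTrace_eq_zero_of_rotation`, `hasTracePUV_Jprop`). The
conventional current differs from `i [H, X_i] S_z` by a term with imaginary trace
(`re_cellTrace_conv_eq`).

Identity. On periodic operators the trace per unit volume is cyclic (`cellTrace_mul_comm`). Since
`P₁` is off-diagonal, in `[H, X_i] S_z P₁` only an off-diagonal part of one of the first two factors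
times the diagonal part of the other contributes. The off-diagonal part of `[H, X_i]` is `[H, [[X_i,
P], P]]`; cyclicity shifts this outer commutator onto the other factors, where `[H, P₁] = [X_j, P]`
appears (`tracial_decomposition`). -/

lemma inner_delta_left (p : Site × Spin) (ψ : Hil) : inner ℂ (delta p) ψ = ψ p := by
  have h := lp.inner_single_left (𝕜 := ℂ) (G := fun _ : Site × Spin => ℂ) p 1 ψ
  refine h.trans ?_
  simp
  rfl

lemma inner_delta_right (p : Site × Spin) (ψ : Hil) : inner ℂ ψ (delta p) = star (ψ p) := by
  rw [← inner_conj_symm, inner_delta_left]; rfl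

lemma hasSum_delta (ψ : Hil) : HasSum (fun q => ψ q • delta q) ψ := by
  have h := lp.hasSum_single (E := fun _ : Site × Spin => ℂ) (p := 2) (by norm_num) ψ
  refine (congrArg (fun f : Site × Spin → Hil => HasSum f ψ) ?_).mp h
  funext q
  refine Hil.ext fun p => ?_
  rw [Hil.smul_apply, delta_apply]
  change (Pi.single q (ψ q) : Site × Spin → ℂ) p = _
  rw [Pi.single_apply]
  split_ifs <;> simp

/-- Evaluation at `p` as a continuous linear functional. -/
def evalAt (p : Site × Spin) : Hil →L[ℂ] ℂ := innerSL ℂ (delta p)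

lemma evalAt_apply (p : Site × Spin) (ψ : Hil) : evalAt p ψ = ψ p := inner_delta_left p ψ

lemma hasSum_apply (A : Op) (ψ : Hil) (p : Site × Spin) :
    HasSum (fun q => ψ q * A (delta q) p) (A ψ p) := by
  have h := (hasSum_delta ψ).mapL ((evalAt p).comp A)
  simpa [evalAt_apply] using h

lemma hasSum_mul_entry (A B : Op) (p q : Site × Spin) :
    HasSum (fun r => A (delta r) p * B (delta q) r) ((A * B) (delta q) p) := by
  simpa [mul_comm] using hasSum_apply A (B (delta q)) p

lemma op_ext {A B : Op} (h : ∀ p q, A (delta q) p = B (delta q) p) : A = B := by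
  ext ψ
  refine Hil.ext fun p => ?_
  refine (hasSum_apply A ψ p).unique ?_
  simpa [h] using hasSum_apply B ψ p

lemma star_entry (A : Op) (p q : Site × Spin) :
    (star A) (delta q) p = star (A (delta p) q) := by
  rw [ContinuousLinearMap.star_eq_adjoint, ← inner_delta_left p,
    ContinuousLinearMap.adjoint_inner_right, inner_delta_right]

lemma mul_entry (A B : Op) (p q : Site × Spin) :
    (A * B) (delta q) p = A (B (delta q)) p := rfl

lemma tendsto_entry {ι : Type*} {l : Filter ι} {F : ι → Op} {A : Op} (h : Tendsto F l (𝓝 A))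
    (p q : Site × Spin) : Tendsto (fun n => F n (delta q) p) l (𝓝 (A (delta q) p)) := by
  have h1 : Continuous fun A : Op => evalAt p (A (delta q)) := by fun_prop
  simp only [evalAt_apply] at h1
  exact (h1.tendsto A).comp h

/-! ### The Schur test -/

lemma norm_sq_eq (ψ : Hil) : HasSum (fun p => ‖ψ p‖ ^ 2) (‖ψ‖ ^ 2) := by
  have h := lp.hasSum_norm (E := fun _ : Site × Spin => ℂ) (p := 2) (by norm_num) ψ
  have h2 : (2 : ENNReal).toReal = 2 := by norm_num
  simp only [h2, Real.rpow_two] at h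
  exact h

lemma norm_le_of_sum_sq_le {ψ : Hil} {C : ℝ} (hC : 0 ≤ C)
    (h : ∀ s : Finset (Site × Spin), ∑ p ∈ s, ‖ψ p‖ ^ 2 ≤ C ^ 2) : ‖ψ‖ ≤ C := by
  have h1 : ‖ψ‖ ^ 2 ≤ C ^ 2 := (norm_sq_eq ψ).summable.tsum_le_of_sum_le h |>.trans' (by
    rw [(norm_sq_eq ψ).tsum_eq])
  exact (sq_le_sq₀ (norm_nonneg _) hC).1 h1

/-- The Schur test. -/
lemma opNorm_le_of_schur {A : Op} {K : Site × Spin → Site × Spin → ℝ} {W : ℝ} (hW : 0 ≤ W)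
    (hK : ∀ p q, ‖A (delta q) p‖ ≤ K p q)
    (hrow : ∀ p (s : Finset (Site × Spin)), ∑ q ∈ s, K p q ≤ W)
    (hcol : ∀ q (s : Finset (Site × Spin)), ∑ p ∈ s, K p q ≤ W) : ‖A‖ ≤ W := by
  have hK0 : ∀ p q, 0 ≤ K p q := fun p q => (norm_nonneg _).trans (hK p q)
  refine A.opNorm_le_bound hW fun ψ => ?_
  refine norm_le_of_sum_sq_le (by positivity) fun G => ?_
  -- Truncating both sums to finite sets leaves finite inequalities only; the row sums pass to the
  -- limit in `F`.
  have hlim : Tendsto (fun F : Finset (Site × Spin) =>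
      ∑ p ∈ G, ‖∑ q ∈ F, ψ q * A (delta q) p‖ ^ 2) atTop (𝓝 (∑ p ∈ G, ‖A ψ p‖ ^ 2)) :=
    tendsto_finsetSum _ fun p _ => ((hasSum_apply A ψ p).norm).pow 2
  refine le_of_tendsto hlim (Eventually.of_forall fun F => ?_)
  have hone : ∀ p, ‖∑ q ∈ F, ψ q * A (delta q) p‖ ^ 2 ≤ W * ∑ q ∈ F, K p q * ‖ψ q‖ ^ 2 := by
    intro p
    have h1 : ‖∑ q ∈ F, ψ q * A (delta q) p‖ ≤ ∑ q ∈ F, K p q * ‖ψ q‖ := by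
      refine (norm_sum_le _ _).trans (Finset.sum_le_sum fun q _ => ?_)
      rw [norm_mul, mul_comm]
      exact mul_le_mul_of_nonneg_right (hK p q) (norm_nonneg _)
    -- Cauchy-Schwarz with the weight split evenly, `K = √K · √K`.
    have h2 : (∑ q ∈ F, K p q * ‖ψ q‖) ^ 2 ≤
        (∑ q ∈ F, K p q) * ∑ q ∈ F, K p q * ‖ψ q‖ ^ 2 :=
      Finset.sum_sq_le_sum_mul_sum_of_sq_le_mul F (fun q _ => hK0 p q)
        (fun q _ => mul_nonneg (hK0 p q) (by positivity)) fun q _ => le_of_eq (by ring)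
    calc _ ≤ (∑ q ∈ F, K p q * ‖ψ q‖) ^ 2 := by gcongr
      _ ≤ _ := h2
      _ ≤ _ := mul_le_mul_of_nonneg_right (hrow p F)
        (Finset.sum_nonneg fun q _ => mul_nonneg (hK0 p q) (by positivity))
  calc _ ≤ ∑ p ∈ G, W * ∑ q ∈ F, K p q * ‖ψ q‖ ^ 2 := Finset.sum_le_sum fun p _ => hone p
    _ = W * ∑ q ∈ F, (∑ p ∈ G, K p q) * ‖ψ q‖ ^ 2 := by
      rw [← Finset.mul_sum, Finset.sum_comm]
      simp_rw [Finset.sum_mul]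
    _ ≤ W * ∑ q ∈ F, W * ‖ψ q‖ ^ 2 := by
      gcongr with q _
      exact hcol q G
    _ = W ^ 2 * ∑ q ∈ F, ‖ψ q‖ ^ 2 := by rw [← Finset.mul_sum]; ring
    _ ≤ W ^ 2 * ‖ψ‖ ^ 2 := by
      gcongr
      exact sum_le_hasSum F (fun _ _ => by positivity) (norm_sq_eq ψ)
    _ = (W * ‖ψ‖) ^ 2 := by ring

/-! ### Commutators with multiplication operators -/

/-- `B` is the commutator of the multiplication by `f` with `A`, as far as matrix elements are
concerned. -/
def IsKernelComm (f : Site → ℝ) (A B : Op) : Prop :=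
  ∀ p q : Site × Spin, B (delta q) p = ((f p.1 : ℂ) - (f q.1 : ℂ)) * A (delta q) p

lemma IsKernelComm.unique {f : Site → ℝ} {A B B' : Op} (h : IsKernelComm f A B)
    (h' : IsKernelComm f A B') : B = B' :=
  op_ext fun p q => by rw [h, h']

lemma IsKernelComm.sub {f : Site → ℝ} {A B A' B' : Op} (h : IsKernelComm f A B)
    (h' : IsKernelComm f A' B') : IsKernelComm f (A - A') (B - B') := fun p q => by
  simp [h p q, h' p q, mul_sub]

lemma IsKernelComm.star {f : Site → ℝ} {A B : Op} (h : IsKernelComm f A B) :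
    IsKernelComm f (star A) (-star B) := fun p q => by
  have := star_entry B p q
  rw [show (-Star.star B) (delta q) p = -((Star.star B) (delta q) p) from rfl, this, star_entry,
    h]
  simp
  ring

/-- The Leibniz rule. -/
lemma IsKernelComm.mul {f : Site → ℝ} {A B A' B' : Op} (h : IsKernelComm f A B)
    (h' : IsKernelComm f A' B') : IsKernelComm f (A * A') (B * A' + A * B') := fun p q => by
  have h1 := (hasSum_mul_entry B A' p q).add (hasSum_mul_entry A B' p q)
  refine h1.unique ?_
  have h2 := (hasSum_mul_entry A A' p q).mul_left ((f p.1 : ℂ) - (f q.1 : ℂ))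
  refine (congrArg (HasSum · _) (funext fun r => ?_)).mp h2
  rw [h, h']
  ring

/-- A bounded function acts as a bounded multiplication operator. -/
lemma exists_mulOp {f : Site → ℝ} {C : ℝ} (hf : ∀ x, |f x| ≤ C) :
    ∃ F : Op, ∀ ψ p, F ψ p = (f p.1 : ℂ) * ψ p := by
  have hC : 0 ≤ C := (abs_nonneg _).trans (hf ((0, 0), 0))
  have hb : ∀ (ψ : Hil) (s : Finset (Site × Spin)),
      ∑ p ∈ s, ‖(f p.1 : ℂ) * ψ p‖ ^ 2 ≤ (C * ‖ψ‖) ^ 2 := by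
    intro ψ s
    calc _ ≤ ∑ p ∈ s, C ^ 2 * ‖ψ p‖ ^ 2 := by
          refine Finset.sum_le_sum fun p _ => ?_
          rw [norm_mul, mul_pow, Complex.norm_real]
          gcongr
          exact hf _
      _ = C ^ 2 * ∑ p ∈ s, ‖ψ p‖ ^ 2 := by rw [Finset.mul_sum]
      _ ≤ C ^ 2 * ‖ψ‖ ^ 2 := by
        gcongr
        exact sum_le_hasSum s (fun _ _ => by positivity) (norm_sq_eq ψ)
      _ = _ := by ring
  have hm : ∀ ψ : Hil, Memℓp (fun p : Site × Spin => (f p.1 : ℂ) * ψ p) 2 := by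
    intro ψ
    refine memℓp_gen' (C := (C * ‖ψ‖) ^ 2) fun s => ?_
    have h2 : (2 : ENNReal).toReal = 2 := by norm_num
    simpa only [h2, Real.rpow_two] using hb ψ s
  let F₀ : Hil →ₗ[ℂ] Hil :=
    { toFun := fun ψ => Hil.mk _ (hm ψ)
      map_add' := fun ψ φ => Hil.ext fun p => by simp [mul_add]
      map_smul' := fun c ψ => Hil.ext fun p => by simp; ring }
  refine ⟨F₀.mkContinuous C fun ψ => norm_le_of_sum_sq_le (by positivity) (hb ψ), fun ψ p => rfl⟩

lemma isKernelComm_mulOp {f : Site → ℝ} {F : Op} (hF : ∀ ψ p, F ψ p = (f p.1 : ℂ) * ψ p)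
    (A : Op) : IsKernelComm f A (F * A - A * F) := fun p q => by
  have hq : F (delta q) = (f q.1 : ℂ) • delta q := Hil.ext fun r => by
    rw [hF, Hil.smul_apply, delta_apply]
    split_ifs with h
    · rw [h]
    · simp
  change F (A (delta q)) p - A (F (delta q)) p = _
  rw [hF, hq, map_smul, Hil.smul_apply]
  ring

/-- A uniform bound on the commutators with approximations of `g` gives the commutator
with `g`. -/
lemma exists_isKernelComm_of_tendsto {f : ℕ → Site → ℝ} {g : Site → ℝ}
    (hfg : ∀ x, Tendsto (fun n => f n x) atTop (𝓝 (g x))) {A : Op} {B : ℕ → Op}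
    (hB : ∀ n, IsKernelComm (f n) A (B n)) {C : ℝ} (hC : ∀ n, ‖B n‖ ≤ C) :
    ∃ B' : Op, IsKernelComm g A B' := by
  have hC0 : 0 ≤ C := (norm_nonneg _).trans (hC 0)
  -- The `B n` are bounded but not known to converge. Limits of coordinates along an ultrafilter
  -- exist by compactness and are automatically linear in `ψ`; on basis vectors they agree with the
  -- ordinary limits.
  let U : Ultrafilter ℕ := hyperfilter ℕ
  have hU : (U : Filter ℕ) ≤ atTop := Nat.hyperfilter_le_atTop
  have hbd : ∀ n ψ, ‖B n ψ‖ ≤ C * ‖ψ‖ := fun n ψ =>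
    ((B n).le_opNorm ψ).trans (mul_le_mul_of_nonneg_right (hC n) (norm_nonneg _))
  have hlim : ∀ (ψ : Hil) (p : Site × Spin), ∃ z : ℂ, Tendsto (fun n => B n ψ p) U (𝓝 z) := by
    intro ψ p
    obtain ⟨z, -, hz⟩ := (isCompact_closedBall (0 : ℂ) (C * ‖ψ‖)).ultrafilter_le_nhds
      (U.map fun n => B n ψ p) (by
        rw [le_principal_iff]
        refine Filter.mem_map.2 (Eventually.of_forall fun n => ?_)
        simpa using (Hil.norm_apply_le _ p).trans (hbd n ψ))
    exact ⟨z, hz⟩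
  choose L hL using hlim
  have hpi : ∀ ψ, Tendsto (id fun n => ((B n ψ : lp (fun _ : Site × Spin => ℂ) 2) :
      Site × Spin → ℂ)) U (𝓝 (L ψ)) := fun ψ => tendsto_pi_nhds.2 (hL ψ)
  have hmem : ∀ ψ, Memℓp (L ψ) 2 := fun ψ =>
    lp.memℓp_of_tendsto (E := fun _ : Site × Spin => ℂ) (p := 2) (F := fun n => B n ψ)
      (isBounded_iff_forall_norm_le.2 ⟨C * ‖ψ‖, by rintro _ ⟨n, rfl⟩; exact hbd n ψ⟩) (hpi ψ)
  let B₀ : Hil →ₗ[ℂ] Hil :=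
    { toFun := fun ψ => Hil.mk _ (hmem ψ)
      map_add' := fun ψ φ => Hil.ext fun p => by
        refine tendsto_nhds_unique (hL (ψ + φ) p) ?_
        simpa using (hL ψ p).add (hL φ p)
      map_smul' := fun c ψ => Hil.ext fun p => by
        refine tendsto_nhds_unique (hL (c • ψ) p) ?_
        simpa using (hL ψ p).const_mul c }
  refine ⟨B₀.mkContinuous C fun ψ => ?_, fun p q => ?_⟩
  · exact lp.norm_le_of_tendsto (E := fun _ : Site × Spin => ℂ) (p := 2)
      (F := fun n => B n ψ) (Eventually.of_forall fun n => hbd n ψ) (hpi ψ)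
  · change L (delta q) p = _
    refine tendsto_nhds_unique (hL (delta q) p) (Tendsto.mono_left ?_ hU)
    have h : ∀ x, Tendsto (fun n => (f n x : ℂ)) atTop (𝓝 (g x : ℂ)) := fun x =>
      (Complex.continuous_ofReal.tendsto _).comp (hfg x)
    simpa only [hB _ p q] using ((h p.1).sub (h q.1)).mul_const _

/-! ### Truncated coordinates -/

/-- The truncation of the `i`-th coordinate at height `n`. -/
def truncPos (i : Fin 2) (n : ℕ) (x : Site) : ℝ := max (-(n : ℝ)) (min (pos x i) n)

lemma abs_truncPos_le (i : Fin 2) (n : ℕ) (x : Site) : |truncPos i n x| ≤ n := by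
  have : (0 : ℝ) ≤ n := Nat.cast_nonneg n
  rw [abs_le]
  exact ⟨le_max_left _ _, max_le (by linarith) (min_le_right _ _)⟩

/-- Clamping is a contraction, so every bound obtained from it is independent of the height `n`. -/
lemma abs_truncPos_sub_le (i : Fin 2) (n : ℕ) (x y : Site) :
    |truncPos i n x - truncPos i n y| ≤ |pos x i - pos y i| := by
  unfold truncPos
  refine (abs_max_sub_max_le_max _ _ _ _).trans ?_
  refine max_le (by simp) ((abs_min_sub_min_le_max _ _ _ _).trans ?_)
  exact max_le le_rfl (by simp)

lemma tendsto_truncPos (i : Fin 2) (x : Site) :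
    Tendsto (fun n => truncPos i n x) atTop (𝓝 (pos x i)) := by
  refine tendsto_const_nhds.congr' ?_
  obtain ⟨N, hN⟩ := exists_nat_ge |pos x i|
  filter_upwards [eventually_ge_atTop N] with n hn
  have h1 : |pos x i| ≤ n := hN.trans (by exact_mod_cast hn)
  rw [abs_le] at h1
  rw [truncPos, min_eq_left h1.2, max_eq_right h1.1]

/-! ### Exponential decay of matrix elements -/

/-- The `1`-norm distance of the cells of two sites. -/
def cellDist (x y : Site) : ℝ := ((|x.1.1 - y.1.1| + |x.1.2 - y.1.2| : ℤ) : ℝ)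

lemma cellDist_nonneg (x y : Site) : 0 ≤ cellDist x y := by
  unfold cellDist
  exact_mod_cast by positivity

/-- Exponential decay of the matrix elements with explicit constants. -/
def HasDecay (C ξ : ℝ) (A : Op) : Prop :=
  ∀ p q : Site × Spin, ‖A (delta q) p‖ ≤ C * Real.exp (-cellDist p.1 q.1 / ξ)

lemma IsShortRange.hasDecay {A : Op} (h : IsShortRange A) :
    ∃ C ξ : ℝ, 0 < C ∧ 0 < ξ ∧ HasDecay C ξ A := by
  obtain ⟨C, ξ, hC, hξ, h⟩ := h
  exact ⟨C, ξ, hC, hξ, fun p q => h p.1.1 q.1.1 p.1.2 q.1.2 p.2 q.2⟩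

lemma summable_exp_abs {ξ : ℝ} (hξ : 0 < ξ) :
    Summable fun n : ℤ => Real.exp (-(|n| : ℤ) / ξ) := by
  have h : Summable fun n : ℕ => Real.exp (-(n : ℝ) / ξ) := by
    have h1 := summable_geometric_of_lt_one (Real.exp_pos (-1 / ξ)).le
      (Real.exp_lt_one_iff.2 (div_neg_of_neg_of_pos (by norm_num) hξ))
    refine h1.congr fun n => ?_
    rw [← Real.exp_nat_mul]
    congr 1
    ring
  refine Summable.of_nat_of_neg (h.congr fun n => ?_) (h.congr fun n => ?_)
  · simp
  · simp

lemma summable_exp_cellDist {ξ : ℝ} (hξ : 0 < ξ) :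
    Summable fun q : Site × Spin => Real.exp (-cellDist 0 q.1 / ξ) := by
  have h1 := (summable_exp_abs hξ).mul_of_nonneg (summable_exp_abs hξ)
    (fun _ => (Real.exp_pos _).le) (fun _ => (Real.exp_pos _).le)
  have hf : Summable fun _ : Fin 2 => (1 : ℝ) := (hasSum_fintype _).summable
  have h2 := h1.mul_of_nonneg hf (fun _ => by positivity) (fun _ => zero_le_one)
  have h3 := h2.mul_of_nonneg hf (fun _ => by positivity) (fun _ => zero_le_one)
  refine h3.congr fun q => ?_
  rw [mul_one, mul_one, ← Real.exp_add]
  congr 1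
  simp [cellDist]
  ring

/-- The point is that `W` depends on `C` and `ξ` alone, so it serves all truncation heights at once.
Row and column sums inject into the sum around the origin by taking differences of cells. -/
lemma HasDecay.opNorm_le (C : ℝ) {ξ : ℝ} (hC : 0 ≤ C) (hξ : 0 < ξ) :
    ∃ W : ℝ, ∀ A : Op, HasDecay C ξ A → ‖A‖ ≤ W := by
  have hs := (summable_exp_cellDist hξ).mul_left C
  set w : Site × Spin → ℝ := fun q => C * Real.exp (-cellDist 0 q.1 / ξ) with hw
  have hw0 : ∀ q, 0 ≤ w q := fun q => by positivity
  refine ⟨∑' q, w q, fun A hA => opNorm_le_of_schur (tsum_nonneg hw0) hA ?_ ?_⟩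
  · intro p s
    let e : Site × Spin ↪ Site × Spin :=
      ⟨fun q => ((p.1.1 - q.1.1, q.1.2), q.2), fun a b h => by
        simp only [Prod.mk.injEq, sub_right_inj] at h
        exact Prod.ext (Prod.ext h.1.1 h.1.2) h.2⟩
    calc _ = ∑ q ∈ s.map e, w q := by
          rw [Finset.sum_map]
          refine Finset.sum_congr rfl fun q _ => ?_
          have he : cellDist 0 (e q).1 = cellDist p.1 q.1 := by
            change ((|0 - (p.1.1.1 - q.1.1.1)| + |0 - (p.1.1.2 - q.1.1.2)| : ℤ) : ℝ) = _
            rw [zero_sub, abs_neg, zero_sub, abs_neg]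
            rfl
          rw [hw]
          simp only [he]
      _ ≤ _ := hs.sum_le_tsum _ fun q _ => hw0 q
  · intro q s
    let e : Site × Spin ↪ Site × Spin :=
      ⟨fun p => ((p.1.1 - q.1.1, p.1.2), p.2), fun a b h => by
        simp only [Prod.mk.injEq, sub_left_inj] at h
        exact Prod.ext (Prod.ext h.1.1 h.1.2) h.2⟩
    calc _ = ∑ q ∈ s.map e, w q := by
          rw [Finset.sum_map]
          refine Finset.sum_congr rfl fun p _ => ?_
          have he : cellDist 0 (e p).1 = cellDist p.1 q.1 := by
            change ((|0 - (p.1.1.1 - q.1.1.1)| + |0 - (p.1.1.2 - q.1.1.2)| : ℤ) : ℝ) = _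
            rw [zero_sub, abs_neg, zero_sub, abs_neg]
            rfl
          rw [hw]
          simp only [he]
      _ ≤ _ := hs.sum_le_tsum _ fun q _ => hw0 q

lemma abs_pos_sub_le (x y : Site) (i : Fin 2) :
    |pos x i - pos y i| ≤ 2 * cellDist x y + 1 := by
  have h1 : (x.1.1 : ℝ) - y.1.1 ≤ |(x.1.1 : ℝ) - y.1.1| := le_abs_self _
  have h2 : (x.1.2 : ℝ) - y.1.2 ≤ |(x.1.2 : ℝ) - y.1.2| := le_abs_self _
  have h3 : -((x.1.1 : ℝ) - y.1.1) ≤ |(x.1.1 : ℝ) - y.1.1| := neg_le_abs _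
  have h4 : -((x.1.2 : ℝ) - y.1.2) ≤ |(x.1.2 : ℝ) - y.1.2| := neg_le_abs _
  have hs : ∀ s : Fin 2, (0 : ℝ) ≤ ((s : ℕ) : ℝ) ∧ ((s : ℕ) : ℝ) ≤ 1 := fun s =>
    ⟨by positivity, by exact_mod_cast Nat.lt_succ_iff.1 s.2⟩
  have hx := hs x.2
  have hy := hs y.2
  have hd : cellDist x y = |(x.1.1 : ℝ) - y.1.1| + |(x.1.2 : ℝ) - y.1.2| := by
    simp [cellDist]
  rw [hd]
  have h30 : 0 ≤ √(3 : ℝ) := Real.sqrt_nonneg _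
  have h32 : √(3 : ℝ) ≤ 2 := by
    rw [Real.sqrt_le_left (by norm_num)]; norm_num
  fin_cases i
  · simp only [Fin.zero_eta, pos_zero]
    rw [abs_le]
    constructor <;> linarith
  · simp only [Fin.mk_one, pos_one]
    rw [← mul_sub, abs_mul, abs_of_nonneg (by positivity)]
    have h5 : |(x.1.1 : ℝ) + x.1.2 - (y.1.1 + y.1.2)| ≤
        |(x.1.1 : ℝ) - y.1.1| + |(x.1.2 : ℝ) - y.1.2| := by
      rw [abs_le]; constructor <;> linarith
    have h6 : 0 ≤ |(x.1.1 : ℝ) + x.1.2 - (y.1.1 + y.1.2)| := abs_nonneg _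
    nlinarith

/-- Half of the decay rate absorbs the linear growth of the coordinate difference: `(1 + t) e^{-t} ≤
1` with `t = d / (2ξ)`. -/
lemma HasDecay.of_isKernelComm {C ξ : ℝ} (hC : 0 ≤ C) (hξ : 0 < ξ) {A B : Op}
    (hA : HasDecay C ξ A) {f : Site → ℝ} {i : Fin 2}
    (hf : ∀ x y, |f x - f y| ≤ |pos x i - pos y i|) (h : IsKernelComm f A B) :
    HasDecay (C * (1 + 4 * ξ)) (2 * ξ) B := by
  intro p q
  rw [h p q, norm_mul, ← Complex.ofReal_sub, Complex.norm_real, Real.norm_eq_abs]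
  set d := cellDist p.1 q.1 with hd
  have hd0 : 0 ≤ d := cellDist_nonneg _ _
  have h1 : |f p.1 - f q.1| ≤ 2 * d + 1 := (hf _ _).trans (abs_pos_sub_le _ _ _)
  have hE : Real.exp (-d / ξ) = Real.exp (-d / (2 * ξ)) * Real.exp (-d / (2 * ξ)) := by
    rw [← Real.exp_add]; congr 1; field_simp; ring
  have h2 : Real.exp (-d / (2 * ξ)) * (1 + d / (2 * ξ)) ≤ 1 := by
    rw [neg_div, Real.exp_neg, inv_mul_le_iff₀ (Real.exp_pos _), mul_one, add_comm]
    exact Real.add_one_le_exp _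
  have h3 : 2 * d + 1 ≤ (1 + 4 * ξ) * (1 + d / (2 * ξ)) := by
    have : (1 + 4 * ξ) * (1 + d / (2 * ξ)) = 1 + 2 * d + 4 * ξ + d / (2 * ξ) := by
      field_simp; ring
    have : 0 ≤ d / (2 * ξ) := by positivity
    linarith
  calc _ ≤ (2 * d + 1) * (C * Real.exp (-d / ξ)) := by
        gcongr
        exact hA p q
    _ ≤ ((1 + 4 * ξ) * (1 + d / (2 * ξ))) * (C * Real.exp (-d / ξ)) := by gcongr
    _ = C * (1 + 4 * ξ) * Real.exp (-d / (2 * ξ)) *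
        (Real.exp (-d / (2 * ξ)) * (1 + d / (2 * ξ))) := by rw [hE]; ring
    _ ≤ C * (1 + 4 * ξ) * Real.exp (-d / (2 * ξ)) * 1 := by gcongr
    _ = _ := mul_one _

/-! ### Operators with bounded commutators -/

/-- The commutators of `A` with the truncated `i`-th coordinates are uniformly bounded. -/
def IsPosLipschitz (i : Fin 2) (A : Op) : Prop :=
  ∃ C : ℝ, ∀ n B, IsKernelComm (truncPos i n) A B → ‖B‖ ≤ C

lemma exists_isKernelComm_truncPos (i : Fin 2) (n : ℕ) :
    ∃ F : Op, ∀ A, IsKernelComm (truncPos i n) A (F * A - A * F) := by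
  obtain ⟨F, hF⟩ := exists_mulOp (abs_truncPos_le i n)
  exact ⟨F, fun A => isKernelComm_mulOp hF A⟩

/-- Truncated coordinates are bounded operators, so estimates can be made with genuine commutators,
free of domain questions. The unbounded coordinate enters only here, in the limit. -/
lemma IsPosLipschitz.exists_isKernelComm {i : Fin 2} {A : Op} (h : IsPosLipschitz i A) :
    ∃ B, IsKernelComm (pos · i) A B := by
  obtain ⟨C, hC⟩ := h
  choose F hF using exists_isKernelComm_truncPos i
  exact exists_isKernelComm_of_tendsto (tendsto_truncPos i) (fun n => hF n A)
    fun n => hC n _ (hF n A)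

lemma HasDecay.isPosLipschitz {C ξ : ℝ} (hC : 0 ≤ C) (hξ : 0 < ξ) {A : Op}
    (hA : HasDecay C ξ A) (i : Fin 2) : IsPosLipschitz i A := by
  obtain ⟨W, hW⟩ := HasDecay.opNorm_le (C * (1 + 4 * ξ)) (by positivity)
    (show (0 : ℝ) < 2 * ξ by positivity)
  exact ⟨W, fun n B hB => hW B (hA.of_isKernelComm hC hξ (abs_truncPos_sub_le i n) hB)⟩

/-- The bounded commutator of `X_i` with `A` on the domain of `X_i`. -/
lemma IsKernelComm.X_apply {i : Fin 2} {A B : Op} (h : IsKernelComm (pos · i) A B)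
    (ψ : (X i).domain) :
    ∃ hA : A ψ ∈ (X i).domain, X i ⟨A ψ, hA⟩ = B ψ + A (X i ψ) := by
  have key : ∀ p, (pos p.1 i : ℂ) * A ψ p = (B ψ + A (X i ψ)) p := by
    intro p
    have h1 := (hasSum_apply B ψ p).add (hasSum_apply A (X i ψ) p)
    refine ((hasSum_apply A ψ p).mul_left (pos p.1 i : ℂ)).unique ?_
    refine (congrArg (HasSum · _) (funext fun q => ?_)).mp h1
    have : (X i ψ) q = (pos q.1 i : ℂ) * (ψ : Hil) q := rfl
    rw [h, this]
    ring
  have hmem : A ψ ∈ (X i).domain := by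
    change Memℓp (fun p : Site × Spin => (pos p.1 i : ℂ) * A ψ p) 2
    exact (congrArg (Memℓp · 2) (funext key)).mpr (Hil.memlp _)
  exact ⟨hmem, Hil.ext key⟩

lemma delta_mem_X (i : Fin 2) (q : Site × Spin) : delta q ∈ (X i).domain := by
  change Memℓp (fun p : Site × Spin => (pos p.1 i : ℂ) * delta q p) 2
  refine (congrArg (Memℓp · 2) (funext fun p => ?_)).mpr
    (Hil.memlp ((pos q.1 i : ℂ) • delta q))
  rw [Hil.smul_apply, delta_apply]
  split_ifs with h
  · rw [h]
  · simp

lemma dense_X_domain (i : Fin 2) : Dense ((X i).domain : Set Hil) := fun ψ =>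
  mem_closure_of_tendsto (hasSum_delta ψ) (Eventually.of_forall fun _ =>
    (X i).domain.sum_mem fun q _ => (X i).domain.smul_mem _ (delta_mem_X i q))

lemma IsBoundedExtension.unique {T : UOp} {B B' : Op} (h : IsBoundedExtension T B)
    (h' : IsBoundedExtension T B') : B = B' := by
  have : (B : Hil → Hil) = B' := Continuous.ext_on h.1 B.continuous B'.continuous
    fun ψ hψ => (h.2 ⟨ψ, hψ⟩).symm.trans (h'.2 ⟨ψ, hψ⟩)
  exact DFunLike.coe_injective this

lemma IsBoundedExtension.extend_eq {T : UOp} {B : Op} (h : IsBoundedExtension T B) :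
    extend T = B := by
  have hex : ∃ B, IsBoundedExtension T B := ⟨B, h⟩
  rw [extend, dif_pos hex]
  exact hex.choose_spec.unique h

lemma mem_toU_domain (A : Op) (ψ : Hil) : ψ ∈ (toU A).domain := Submodule.mem_top

lemma IsKernelComm.isBoundedExtension {i : Fin 2} {A B : Op}
    (h : IsKernelComm (pos · i) A B) : IsBoundedExtension (commU (X i) (toU A)) B := by
  have hX : ∀ ψ ∈ (prodU (toU A) (X i)).domain, ψ ∈ (X i).domain := fun ψ hψ =>
    ((mem_prodU_domain _ _ _).1 hψ).1
  constructor
  · refine (dense_X_domain i).mono fun ψ hψ => ?_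
    refine ⟨(mem_prodU_domain _ _ _).2 ⟨mem_toU_domain A ψ, (h.X_apply ⟨ψ, hψ⟩).1⟩,
      (mem_prodU_domain _ _ _).2 ⟨hψ, mem_toU_domain _ _⟩⟩
  · rintro ⟨ψ, h1, h2⟩
    obtain ⟨h3, h4⟩ := h.X_apply ⟨ψ, hX ψ h2⟩
    have : commU (X i) (toU A) ⟨ψ, h1, h2⟩ = X i ⟨A ψ, h3⟩ - A (X i ⟨ψ, hX ψ h2⟩) := rfl
    rw [this, h4]
    simp

lemma IsKernelComm.isBoundedExtension_neg {i : Fin 2} {A B : Op}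
    (h : IsKernelComm (pos · i) A B) : IsBoundedExtension (commU (toU A) (X i)) (-B) := by
  have hX : ∀ ψ ∈ (prodU (toU A) (X i)).domain, ψ ∈ (X i).domain := fun ψ hψ =>
    ((mem_prodU_domain _ _ _).1 hψ).1
  constructor
  · refine (dense_X_domain i).mono fun ψ hψ => ?_
    refine ⟨(mem_prodU_domain _ _ _).2 ⟨hψ, mem_toU_domain _ _⟩,
      (mem_prodU_domain _ _ _).2 ⟨mem_toU_domain A ψ, (h.X_apply ⟨ψ, hψ⟩).1⟩⟩
  · rintro ⟨ψ, h1, h2⟩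
    obtain ⟨h3, h4⟩ := h.X_apply ⟨ψ, hX ψ h1⟩
    have : commU (toU A) (X i) ⟨ψ, h1, h2⟩ = A (X i ⟨ψ, hX ψ h1⟩) - X i ⟨A ψ, h3⟩ := rfl
    rw [this, h4]
    simp

lemma IsKernelComm.commXA_eq {i : Fin 2} {A B : Op} (h : IsKernelComm (pos · i) A B) :
    commXA i A = B := h.isBoundedExtension.extend_eq

lemma IsKernelComm.commAX_eq {i : Fin 2} {A B : Op} (h : IsKernelComm (pos · i) A B) :
    commAX A i = -B := h.isBoundedExtension_neg.extend_eq

/-! ### Spectral projections and the Sylvester equation -/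

section CStar

variable {A : Type*} [CStarAlgebra A]

/-- The spectral projection of `H` for `(-∞, μ]`. -/
def lowerProj (H : A) (μ : ℝ) : A := cfc (Set.indicator (Set.Iic μ) fun _ : ℝ => (1 : ℝ)) H

/-- The only possible jump is at `μ`, outside `s`. Without this continuity the functional calculus
would return its default value `0`. -/
lemma continuousOn_ite_of_gap {f : ℝ → ℝ} {s : Set ℝ} {μ : ℝ} (hμ : μ ∉ s)
    (hf : ContinuousOn f (s ∩ Set.Ioi μ)) :
    ContinuousOn (fun x => if x ≤ μ then 0 else f x) s := by
  intro x hx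
  rcases lt_trichotomy x μ with h | rfl | h
  · refine (continuousWithinAt_const (b := (0 : ℝ))).congr_of_eventuallyEq ?_ (by simp [h.le])
    filter_upwards [mem_nhdsWithin_of_mem_nhds (Iio_mem_nhds h)] with y hy
    simp [(Set.mem_Iio.1 hy).le]
  · exact absurd hx hμ
  · have h1 : ContinuousWithinAt f s x := by
      have := hf x ⟨hx, h⟩
      rwa [continuousWithinAt_inter (Ioi_mem_nhds h)] at this
    refine h1.congr_of_eventuallyEq ?_ (by simp [h])
    filter_upwards [mem_nhdsWithin_of_mem_nhds (Ioi_mem_nhds h)] with y hy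
    simp [Set.mem_Ioi.1 hy]

lemma lowerProj_isSelfAdjoint (H : A) (μ : ℝ) : IsSelfAdjoint (lowerProj H μ) :=
  cfc_predicate _ _

lemma Commute.lowerProj {H B : A} (h : Commute H B) (μ : ℝ) : Commute (lowerProj H μ) B :=
  h.cfc_real _

lemma lowerProj_comm (H : A) (μ : ℝ) : Commute (lowerProj H μ) H :=
  Commute.lowerProj (Commute.refl H) μ

lemma one_sub_lowerProj_eq {H : A} (hH : IsSelfAdjoint H) {μ : ℝ} (hμ : μ ∉ spectrum ℝ H) :
    1 - lowerProj H μ = cfc (fun x : ℝ => if x ≤ μ then 0 else (1 : ℝ)) H := by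
  have hc := continuousOn_ite_of_gap (f := fun _ => (1 : ℝ)) hμ continuousOn_const
  have h : Set.indicator (Set.Iic μ) (fun _ : ℝ => (1 : ℝ)) =
      fun x => 1 - if x ≤ μ then 0 else (1 : ℝ) := by
    funext x
    by_cases hx : x ≤ μ <;> simp [hx]
  rw [SpinHall.lowerProj, h, cfc_sub _ _ _ continuousOn_const hc, cfc_const_one ℝ H]
  simp

lemma lowerProj_mul_self {H : A} (hH : IsSelfAdjoint H) {μ : ℝ} (hμ : μ ∉ spectrum ℝ H) :
    lowerProj H μ * lowerProj H μ = lowerProj H μ := by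
  have hc := continuousOn_ite_of_gap (f := fun _ => (1 : ℝ)) hμ continuousOn_const
  have h : (1 - lowerProj H μ) * (1 - lowerProj H μ) = 1 - lowerProj H μ := by
    rw [one_sub_lowerProj_eq hH hμ, ← cfc_mul _ _ _ hc hc]
    congr 1
    funext x
    split_ifs <;> simp
  have h2 : (1 - lowerProj H μ) * (1 - lowerProj H μ) =
      1 - lowerProj H μ - (lowerProj H μ - lowerProj H μ * lowerProj H μ) := by noncomm_ring
  rw [h2, sub_eq_self, sub_eq_zero] at h
  exact h.symm

/-- The two off-diagonal corners of `Q` are controlled by the commutator of `Q` with `H` when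
the spectral projection belongs to a gap of the spectrum of `H`. -/
lemma exists_norm_corner_le {H : A} (hH : IsSelfAdjoint H) {μ : ℝ} (hμ : μ ∉ spectrum ℝ H) :
    ∃ c : ℝ, 0 ≤ c ∧ ∀ Q : A,
      ‖lowerProj H μ * Q * (1 - lowerProj H μ)‖ ≤ c * ‖H * Q - Q * H‖ ∧
      ‖(1 - lowerProj H μ) * Q * lowerProj H μ‖ ≤ c * ‖H * Q - Q * H‖ := by
  obtain ⟨g, hg, hball⟩ := Metric.isOpen_iff.1 (spectrum.isClosed (𝕜 := ℝ) H).isOpen_compl μ hμ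
  -- `R` is so large that `c = μ - R` lies below the spectrum. Then `K = H - c` has norm at most `R
  -- - g` on the range of `P`, while its inverse on the complement has norm at most `(R + g)⁻¹`.
  set R : ℝ := ‖H‖ * ‖(1 : A)‖ + |μ| + g with hR
  set c : ℝ := μ - R with hc
  have hμ1 := neg_abs_le μ
  have hμ2 := le_abs_self μ
  have hn : 0 ≤ ‖H‖ * ‖(1 : A)‖ := by positivity
  have hgap : ∀ x ∈ spectrum ℝ H, x ≤ μ - g ∨ μ + g ≤ x := by
    intro x hx
    by_contra! h
    refine hball (?_ : x ∈ Metric.ball μ g) hx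
    rw [Metric.mem_ball, Real.dist_eq, abs_lt]
    constructor <;> linarith
  have hnorm : ∀ x ∈ spectrum ℝ H, -(‖H‖ * ‖(1 : A)‖) ≤ x := by
    intro x hx
    have h1 := spectrum.norm_le_norm_mul_of_mem hx
    rw [Real.norm_eq_abs] at h1
    linarith [neg_abs_le x]
  set P := lowerProj H μ with hP
  set N := 1 - P with hN
  have hPP : P * P = P := lowerProj_mul_self hH hμ
  have hNcfc : N = cfc (fun x : ℝ => if x ≤ μ then 0 else (1 : ℝ)) H :=
    one_sub_lowerProj_eq hH hμ
  have hc1 := continuousOn_ite_of_gap (f := fun _ => (1 : ℝ)) hμ continuousOn_const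
  set K : A := cfc (fun x : ℝ => x - c) H with hK
  have hKH : ∀ Q : A, K * Q - Q * K = H * Q - Q * H := by
    intro Q
    have : K = H - algebraMap ℝ A c := by
      rw [hK, cfc_sub (fun x : ℝ => x) (fun _ => c) H, cfc_id' ℝ H, cfc_const c H]
    rw [this, sub_mul, mul_sub, Algebra.commutes c Q]
    abel
  have hcG : ContinuousOn (fun x : ℝ => if x ≤ μ then 0 else (x - c)⁻¹) (spectrum ℝ H) := by
    refine continuousOn_ite_of_gap hμ (ContinuousOn.inv₀ (by fun_prop) fun x hx => ?_)
    have : μ < x := hx.2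
    have : 0 < x - c := by rw [hc, hR]; linarith [abs_nonneg μ]
    exact this.ne'
  set G : A := cfc (fun x : ℝ => if x ≤ μ then 0 else (x - c)⁻¹) H with hG
  have hcK : ContinuousOn (fun x : ℝ => x - c) (spectrum ℝ H) := by fun_prop
  have hKG : K * G = N := by
    rw [hK, hG, hNcfc, ← cfc_mul _ _ _ hcK hcG]
    refine cfc_congr fun x hx => ?_
    by_cases h : x ≤ μ
    · simp [h]
    · have : 0 < x - c := by rw [hc, hR]; push Not at h; linarith [abs_nonneg μ]
      simp only [h, if_false]
      exact mul_inv_cancel₀ this.ne'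
  have hGK : G * K = N := by rw [← hKG]; exact cfc_commute_cfc _ _ _
  have hNG : N * G = G := by
    rw [hG, hNcfc, ← cfc_mul _ _ _ hc1 hcG]
    congr 1
    funext x
    split_ifs <;> simp
  have hGN : G * N = G := by
    refine Eq.trans ?_ hNG
    rw [hG, hNcfc]
    exact cfc_commute_cfc _ _ _
  have hPcfc : P = cfc (fun x : ℝ => 1 - if x ≤ μ then 0 else (1 : ℝ)) H := by
    rw [cfc_sub _ _ _ continuousOn_const hc1, cfc_const_one ℝ H, ← hNcfc, hN]
    simp
  have hcP : ContinuousOn (fun x : ℝ => 1 - if x ≤ μ then 0 else (1 : ℝ)) (spectrum ℝ H) :=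
    continuousOn_const.sub hc1
  set E : A := K * P with hE
  have hPK : P * K = E := by rw [hE, hPcfc]; exact cfc_commute_cfc _ _ _
  have hEP : E * P = E := by rw [hE, mul_assoc, hPP]
  have hPE : P * E = E := by rw [← hPK, ← mul_assoc, hPP]
  have hEn : ‖E‖ ≤ R - g := by
    rw [hE, hPcfc, ← cfc_mul _ _ _ hcK hcP]
    refine norm_cfc_le (by rw [hR]; linarith [abs_nonneg μ]) fun x hx => ?_
    by_cases h : x ≤ μ
    · have h1 : x ≤ μ - g := (hgap x hx).resolve_right (by linarith)
      have h2 := hnorm x hx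
      simp only [h, if_true, sub_zero, mul_one, Real.norm_eq_abs]
      rw [abs_le]
      constructor <;> linarith
    · simp only [h, if_false, sub_self, mul_zero, norm_zero]
      rw [hR]; linarith [abs_nonneg μ]
  have hRg : 0 < R + g := by rw [hR]; linarith [abs_nonneg μ]
  have hGn : ‖G‖ ≤ (R + g)⁻¹ := by
    refine norm_cfc_le (by positivity) fun x hx => ?_
    by_cases h : x ≤ μ
    · simp only [h, if_true, norm_zero]
      positivity
    · have h1 : μ + g ≤ x := (hgap x hx).resolve_left (by linarith)
      have h2 : R + g ≤ x - c := by rw [hc]; linarith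
      simp only [h, if_false, Real.norm_eq_abs]
      rw [abs_of_nonneg (inv_nonneg.2 (by linarith))]
      gcongr
  have hPn : ‖P‖ ≤ 1 := by
    refine norm_cfc_le zero_le_one fun x _ => ?_
    by_cases h : x ≤ μ <;> simp [h]
  -- The contraction factor `(R - g) / (R + g)` is below one; clearing denominators gives `2 g a ≤
  -- b`.
  have hfin : ∀ a b : ℝ, 0 ≤ a → a ≤ (R - g) * a * (R + g)⁻¹ + b * (R + g)⁻¹ →
      a ≤ 1 / (2 * g) * b := by
    intro a b _ h
    rw [← add_mul, ← div_eq_mul_inv, le_div_iff₀ hRg] at h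
    rw [div_mul_eq_mul_div, one_mul, le_div_iff₀ (by positivity)]
    linarith
  refine ⟨1 / (2 * g), by positivity, fun Q => ?_⟩
  rw [← hKH Q]
  constructor
  · have h : P * Q * N = E * (P * Q * N) * G - P * (K * Q - Q * K) * G := by
      have h1 : P * (K * Q - Q * K) * G = (P * K) * Q * G - P * Q * (K * G) := by noncomm_ring
      have h2 : E * (P * Q * N) * G = (E * P) * Q * (N * G) := by noncomm_ring
      rw [h1, h2, hPK, hKG, hEP, hNG]
      abel
    refine hfin _ _ (norm_nonneg _) ?_
    calc ‖P * Q * N‖ = ‖E * (P * Q * N) * G - P * (K * Q - Q * K) * G‖ := by rw [← h]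
      _ ≤ ‖E‖ * ‖P * Q * N‖ * ‖G‖ + ‖P‖ * ‖K * Q - Q * K‖ * ‖G‖ :=
        (norm_sub_le _ _).trans (add_le_add norm_mul₃_le norm_mul₃_le)
      _ ≤ (R - g) * ‖P * Q * N‖ * (R + g)⁻¹ + 1 * ‖K * Q - Q * K‖ * (R + g)⁻¹ := by
        have : 0 ≤ R - g := (norm_nonneg _).trans hEn
        gcongr
      _ = _ := by rw [one_mul]
  · have h : N * Q * P = G * (N * Q * P) * E + G * (K * Q - Q * K) * P := by
      have h1 : G * (K * Q - Q * K) * P = (G * K) * Q * P - G * Q * (K * P) := by noncomm_ring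
      have h2 : G * (N * Q * P) * E = (G * N) * Q * (P * E) := by noncomm_ring
      rw [h1, h2, hGK, hGN, hPE]
      abel
    refine hfin _ _ (norm_nonneg _) ?_
    calc ‖N * Q * P‖ = ‖G * (N * Q * P) * E + G * (K * Q - Q * K) * P‖ := by rw [← h]
      _ ≤ ‖G‖ * ‖N * Q * P‖ * ‖E‖ + ‖G‖ * ‖K * Q - Q * K‖ * ‖P‖ :=
        (norm_add_le _ _).trans (add_le_add norm_mul₃_le norm_mul₃_le)
      _ ≤ (R + g)⁻¹ * ‖N * Q * P‖ * (R - g) + (R + g)⁻¹ * ‖K * Q - Q * K‖ * 1 := by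
        gcongr
      _ = _ := by ring

/-- Off-diagonal operators are controlled by their commutator with `H`. -/
lemma exists_norm_le_of_offDiag {H : A} (hH : IsSelfAdjoint H) {μ : ℝ} (hμ : μ ∉ spectrum ℝ H) :
    ∃ c : ℝ, 0 ≤ c ∧ ∀ Q : A, Q * lowerProj H μ + lowerProj H μ * Q = Q →
      ‖Q‖ ≤ 2 * c * ‖H * Q - Q * H‖ := by
  obtain ⟨c, hc, hbd⟩ := exists_norm_corner_le hH hμ
  set P := lowerProj H μ with hPdef
  have hPP : P * P = P := lowerProj_mul_self hH hμ
  refine ⟨c, hc, fun Q hQ => ?_⟩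
  have h0 : P * Q * P = 0 := by
    have h1 : P * (Q * P + P * Q) = P * Q := by rw [hQ]
    rw [mul_add, ← mul_assoc, ← mul_assoc, hPP] at h1
    simpa using h1
  have h2 : Q = P * Q * (1 - P) + (1 - P) * Q * P := by
    have : P * Q * (1 - P) + (1 - P) * Q * P = Q * P + P * Q - 2 • (P * Q * P) := by
      noncomm_ring
    rw [this, h0, hQ]
    simp
  calc ‖Q‖ ≤ ‖P * Q * (1 - P)‖ + ‖(1 - P) * Q * P‖ := by
        conv_lhs => rw [h2]
        exact norm_add_le _ _
    _ ≤ c * ‖H * Q - Q * H‖ + c * ‖H * Q - Q * H‖ := add_le_add (hbd Q).1 (hbd Q).2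
    _ = _ := by ring

/-! ### The linear response integral -/

/-- The integrand of the linear response. -/
def responseIntegrand (H : A) (η : ℝ) (B : A) (s : ℝ) : A :=
  (Real.exp (η * s) : ℂ) • (NormedSpace.exp ((Complex.I * (s : ℂ)) • H) * B *
    NormedSpace.exp ((-(Complex.I * (s : ℂ))) • H))

/-- The operator `i ∫_{-∞}^0 e^{ηs} e^{isH} B e^{-isH} ds`. -/
def response (H : A) (η : ℝ) (B : A) : A :=
  Complex.I • ∫ s in Set.Iic (0 : ℝ), responseIntegrand H η B s

lemma smul_I_eq (H : A) (s : ℝ) : (Complex.I * (s : ℂ)) • H = s • (Complex.I • H) := by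
  rw [mul_comm, mul_smul, Complex.coe_smul]

lemma smul_neg_I_eq (H : A) (s : ℝ) : (-(Complex.I * (s : ℂ))) • H = s • (-(Complex.I • H)) := by
  rw [neg_smul, smul_I_eq, smul_neg]

lemma norm_exp_mul_mul_exp_le {H : A} (hH : IsSelfAdjoint H) (B : A) (s : ℝ) :
    ‖NormedSpace.exp ((Complex.I * (s : ℂ)) • H) * B *
      NormedSpace.exp ((-(Complex.I * (s : ℂ))) • H)‖ ≤ ‖B‖ := by
  have h : ∀ t : ℝ, NormedSpace.exp ((Complex.I * (t : ℂ)) • H) ∈ unitary A := by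
    intro t
    have := (selfAdjoint.expUnitary ⟨t • H, (IsSelfAdjoint.all t).smul hH⟩).2
    rw [selfAdjoint.expUnitary_coe] at this
    rwa [mul_smul, Complex.coe_smul]
  have h2 := h (-s)
  rw [Complex.ofReal_neg, mul_neg] at h2
  rw [CStarRing.norm_mul_mem_unitary _ h2, CStarRing.norm_mem_unitary_mul _ (h s)]

lemma norm_responseIntegrand_le {H : A} (hH : IsSelfAdjoint H) (η : ℝ) (B : A) (s : ℝ) :
    ‖responseIntegrand H η B s‖ ≤ Real.exp (η * s) * ‖B‖ := by
  rw [responseIntegrand, norm_smul, Complex.norm_real, Real.norm_eq_abs, Real.abs_exp]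
  gcongr
  exact norm_exp_mul_mul_exp_le hH B s

/-- The derivative is again an integrand, with the Liouvillian applied to the source. Integrating it
over the half-line leaves only the boundary value at `0`, which inverts the Liouvillian. -/
lemma hasDerivAt_responseIntegrand (H : A) (η : ℝ) (B : A) (s : ℝ) :
    HasDerivAt (responseIntegrand H η B)
      (Complex.I • responseIntegrand H η
        (H * B - B * H - (Complex.I * η) • B) s) s := by
  have h1 := hasDerivAt_exp_smul_const (𝕂 := ℝ) (Complex.I • H) s
  have h2 := hasDerivAt_exp_smul_const' (𝕂 := ℝ) (-(Complex.I • H)) s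
  have h3 : HasDerivAt (fun s : ℝ => Real.exp (η * s)) (Real.exp (η * s) * η) s := by
    simpa using ((hasDerivAt_id s).const_mul η).exp
  have h4 := h3.smul ((h1.mul_const B).mul h2)
  have hfun : responseIntegrand H η B = fun s : ℝ => Real.exp (η * s) •
      (NormedSpace.exp (s • (Complex.I • H)) * B * NormedSpace.exp (s • (-(Complex.I • H)))) := by
    funext t
    rw [responseIntegrand, smul_I_eq, smul_neg_I_eq, Complex.coe_smul]
  rw [hfun]
  refine h4.congr_deriv ?_
  rw [responseIntegrand, smul_I_eq, smul_neg_I_eq, Complex.coe_smul]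
  set U := NormedSpace.exp (s • (Complex.I • H))
  set V := NormedSpace.exp (s • (-(Complex.I • H)))
  have hη : (Complex.I * (Complex.I * (η : ℂ))) = ((-η : ℝ) : ℂ) := by
    rw [← mul_assoc, Complex.I_mul_I]; simp
  have hW : Complex.I • (H * B - B * H - (Complex.I * η) • B) =
      (Complex.I • H) * B - B * (Complex.I • H) + η • B := by
    rw [smul_sub, smul_sub, smul_smul, hη, Complex.coe_smul, smul_mul_assoc, mul_smul_comm,
      neg_smul, sub_neg_eq_add]
  rw [smul_comm Complex.I (Real.exp (η * s)), ← smul_mul_assoc Complex.I, ← mul_smul_comm Complex.I,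
    hW]
  change _ + (Real.exp (η * s) * η) • (U * B * V) = _
  set Z := Complex.I • H
  simp only [mul_add, add_mul, mul_sub, sub_mul, smul_add, smul_sub, mul_neg, neg_mul,
    smul_neg, mul_smul_comm, smul_mul_assoc, mul_assoc, smul_smul]
  abel

lemma continuous_responseIntegrand (H : A) (η : ℝ) (B : A) :
    Continuous (responseIntegrand H η B) :=
  continuous_iff_continuousAt.2 fun s => (hasDerivAt_responseIntegrand H η B s).continuousAt

lemma integrableOn_responseIntegrand {H : A} (hH : IsSelfAdjoint H) {η : ℝ} (hη : 0 < η) (B : A) :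
    MeasureTheory.IntegrableOn (responseIntegrand H η B) (Set.Iic 0) := by
  refine MeasureTheory.Integrable.mono' ((integrableOn_exp_mul_Iic hη 0).mul_const ‖B‖)
    (continuous_responseIntegrand H η B).aestronglyMeasurable ?_
  exact Eventually.of_forall fun s => norm_responseIntegrand_le hH η B s

lemma norm_response_le {H : A} (hH : IsSelfAdjoint H) {η : ℝ} (hη : 0 < η) (B : A) :
    ‖response H η B‖ ≤ ‖B‖ / η := by
  rw [response, norm_smul, Complex.norm_I, one_mul]
  refine (MeasureTheory.norm_integral_le_of_norm_le
    ((integrableOn_exp_mul_Iic hη 0).mul_const ‖B‖)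
    (Eventually.of_forall fun s => norm_responseIntegrand_le hH η B s)).trans ?_
  rw [MeasureTheory.integral_mul_const, integral_exp_mul_Iic hη]
  simp [div_eq_inv_mul]

/-- Bounded maps that commute with the evolution pass through the integral. Multiplication by
elements commuting with `H` is of this kind, which transfers symmetries from the source to the
response. -/
lemma response_map {H : A} (hH : IsSelfAdjoint H) {η : ℝ} (hη : 0 < η) (T : A →L[ℂ] A)
    (hT : ∀ B s, T (responseIntegrand H η B s) = responseIntegrand H η (T B) s) (B : A) :
    response H η (T B) = T (response H η B) := by
  rw [response, response, map_smul,
    ← T.integral_comp_comm (integrableOn_responseIntegrand hH hη B)]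
  simp only [hT]

lemma Commute.exp_smul_right {H C : A} (h : Commute H C) (z : ℂ) :
    Commute (NormedSpace.exp (z • H)) C :=
  ((h.smul_left z).exp_left)

lemma response_mul_left {H : A} (hH : IsSelfAdjoint H) {η : ℝ} (hη : 0 < η) {C : A}
    (hC : Commute H C) (B : A) : response H η (C * B) = C * response H η B := by
  refine response_map hH hη (ContinuousLinearMap.mul ℂ A C) (fun B s => ?_) B
  simp only [ContinuousLinearMap.mul_apply', responseIntegrand, mul_smul_comm]
  rw [← mul_assoc, ← mul_assoc, ← mul_assoc, (Commute.exp_smul_right hC _).eq]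

lemma response_mul_right {H : A} (hH : IsSelfAdjoint H) {η : ℝ} (hη : 0 < η) {C : A}
    (hC : Commute H C) (B : A) : response H η (B * C) = response H η B * C := by
  refine response_map hH hη ((ContinuousLinearMap.mul ℂ A).flip C) (fun B s => ?_) B
  simp only [ContinuousLinearMap.flip_apply, ContinuousLinearMap.mul_apply', responseIntegrand,
    smul_mul_assoc]
  rw [mul_assoc _ _ C, (Commute.exp_smul_right hC _).eq]
  simp only [mul_assoc]

lemma response_smul (H : A) (η : ℝ) (c : ℂ) (B : A) :
    response H η (c • B) = c • response H η B := by
  have h : ∀ s, responseIntegrand H η (c • B) s = c • responseIntegrand H η B s := fun s => by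
    simp only [responseIntegrand, mul_smul_comm, smul_mul_assoc]
    rw [smul_comm]
  simp only [response, h]
  rw [MeasureTheory.integral_smul, smul_comm]

lemma response_add {H : A} (hH : IsSelfAdjoint H) {η : ℝ} (hη : 0 < η) (B B' : A) :
    response H η (B + B') = response H η B + response H η B' := by
  rw [response, response, response, ← smul_add, ← MeasureTheory.integral_add
    (integrableOn_responseIntegrand hH hη B) (integrableOn_responseIntegrand hH hη B')]
  congr 2
  funext s
  simp only [responseIntegrand, mul_add, add_mul, smul_add]

lemma response_sub {H : A} (hH : IsSelfAdjoint H) {η : ℝ} (hη : 0 < η) (B B' : A) :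
    response H η (B - B') = response H η B - response H η B' := by
  have h := response_add hH hη B ((-1 : ℂ) • B')
  rw [response_smul] at h
  simpa [sub_eq_add_neg] using h

/-- The linear response inverts the Liouvillian `Q ↦ [H, Q] - i η Q` from the left. -/
lemma response_liouvillian {H : A} (hH : IsSelfAdjoint H) {η : ℝ} (hη : 0 < η) (Q : A) :
    response H η (H * Q - Q * H - (Complex.I * η) • Q) = Q := by
  have h := MeasureTheory.integral_Iic_of_hasDerivAt_of_tendsto' (a := 0) (m := 0)
    (fun s _ => hasDerivAt_responseIntegrand H η Q s)
    ((integrableOn_responseIntegrand hH hη _).smul Complex.I) (by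
      refine squeeze_zero_norm (norm_responseIntegrand_le hH η Q) ?_
      have h1 : Tendsto (fun s : ℝ => η * s) atBot atBot := tendsto_id.const_mul_atBot hη
      simpa using (Real.tendsto_exp_atBot.comp h1).mul_const ‖Q‖)
  rw [MeasureTheory.integral_smul] at h
  rw [response, h]
  simp [responseIntegrand]

/-- The linear response inverts the Liouvillian `Q ↦ [H, Q] - i η Q` from the right. -/
lemma liouvillian_response {H : A} (hH : IsSelfAdjoint H) {η : ℝ} (hη : 0 < η) (B : A) :
    H * response H η B - response H η B * H - (Complex.I * η) • response H η B = B := by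
  rw [← response_mul_left hH hη (Commute.refl H), ← response_mul_right hH hη (Commute.refl H),
    ← response_smul, ← response_sub hH hη, ← response_sub hH hη, response_liouvillian hH hη]

/-- A solution of the Liouville equation is bounded by the right-hand side. -/
lemma norm_le_of_liouvillian {H : A} (hH : IsSelfAdjoint H) {η : ℝ} (hη : 0 < η) (Q : A) :
    ‖Q‖ ≤ ‖H * Q - Q * H - (Complex.I * η) • Q‖ / η := by
  conv_lhs => rw [← response_liouvillian hH hη Q]
  exact norm_response_le hH hη _

/-- The adjoint of the response solves the same Liouville equation, whose solution is unique for `η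
> 0`. -/
lemma response_isSelfAdjoint {H : A} (hH : IsSelfAdjoint H) {η : ℝ} (hη : 0 < η) {B : A}
    (hB : star B = -B) : IsSelfAdjoint (response H η B) := by
  set L := response H η B with hL
  have h := liouvillian_response hH hη B
  rw [← hL] at h
  have h1 : H * star L - star L * H - (Complex.I * η) • star L = B := by
    have h2 := congrArg star h
    rw [hB, star_sub, star_sub, star_mul, star_mul, hH.star_eq, star_smul] at h2
    have h3 : star (Complex.I * (η : ℂ)) = -(Complex.I * η) := by simp
    rw [h3, neg_smul] at h2
    rw [← neg_inj, ← h2]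
    abel
  have h4 := response_liouvillian hH hη (star L)
  rw [h1, ← hL] at h4
  exact h4.symm

/-- An off-diagonal source has an off-diagonal response. -/
lemma response_offDiag {H : A} (hH : IsSelfAdjoint H) {η : ℝ} (hη : 0 < η) {P B : A}
    (hP : Commute H P) (hB : B * P + P * B = B) :
    response H η B * P + P * response H η B = response H η B := by
  rw [← response_mul_left hH hη hP, ← response_mul_right hH hη hP, ← response_add hH hη, hB]

/-- For an off-diagonal source the linear response converges as `η → 0`. -/
lemma exists_tendsto_response {H : A} (hH : IsSelfAdjoint H) {μ : ℝ} (hμ : μ ∉ spectrum ℝ H)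
    {B : A} (hB : B * lowerProj H μ + lowerProj H μ * B = B) :
    ∃ L : A, Tendsto (fun η => response H η B) (𝓝[>] 0) (𝓝 L) := by
  set P := lowerProj H μ with hPdef
  obtain ⟨c, hc, hoff⟩ := exists_norm_le_of_offDiag hH hμ
  rw [← hPdef] at hoff
  have hL : ∀ η : ℝ, 0 < η → H * response H η B - response H η B * H =
      B + (Complex.I * η) • response H η B := fun η hη =>
    sub_eq_iff_eq_add.1 (liouvillian_response hH hη B)
  have hnI : ∀ η : ℝ, 0 < η → ‖(Complex.I * (η : ℂ))‖ = η := fun η hη => by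
    simp [abs_of_pos hη]
  have hoffL : ∀ η : ℝ, 0 < η → response H η B * P + P * response H η B = response H η B :=
    fun η hη => response_offDiag hH hη ((lowerProj_comm H μ).symm) hB
  -- The gap estimate gives `‖L‖ ≤ 2c (‖B‖ + η ‖L‖)`; for `4 c η ≤ 1` at most half of `‖L‖` is on
  -- the right and can be absorbed.
  have hbound : ∀ η : ℝ, 0 < η → 4 * c * η ≤ 1 → ‖response H η B‖ ≤ 4 * c * ‖B‖ := by
    intro η hη hsmall
    have h1 := hoff _ (hoffL η hη)
    rw [hL η hη] at h1
    have h2 : ‖B + (Complex.I * (η : ℂ)) • response H η B‖ ≤ ‖B‖ + η * ‖response H η B‖ := by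
      refine (norm_add_le _ _).trans ?_
      rw [norm_smul, hnI η hη]
    have h3 : ‖response H η B‖ ≤ 2 * c * (‖B‖ + η * ‖response H η B‖) := h1.trans (by gcongr)
    nlinarith [norm_nonneg (response H η B)]
  -- The source cancels in the difference of two responses, so its commutator with `H` is only `i η
  -- L_η - i η' L_η'`.
  have hdiff : ∀ η η' : ℝ, 0 < η → 0 < η' → 4 * c * η ≤ 1 → 4 * c * η' ≤ 1 →
      ‖response H η B - response H η' B‖ ≤ 8 * c ^ 2 * ‖B‖ * (η + η') := by
    intro η η' hη hη' hs hs'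
    have h1 := hoff (response H η B - response H η' B) (by
      rw [sub_mul, mul_sub, ← add_sub_add_comm, hoffL η hη, hoffL η' hη'])
    have h2 : H * (response H η B - response H η' B) - (response H η B - response H η' B) * H =
        (Complex.I * η) • response H η B - (Complex.I * η') • response H η' B := by
      have e1 := hL η hη
      have e2 := hL η' hη'
      calc _ = (H * response H η B - response H η B * H) -
            (H * response H η' B - response H η' B * H) := by noncomm_ring
        _ = _ := by rw [e1, e2]; abel
    rw [h2] at h1
    have h3 : ‖(Complex.I * (η : ℂ)) • response H η B - (Complex.I * (η' : ℂ)) • response H η' B‖ ≤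
        η * (4 * c * ‖B‖) + η' * (4 * c * ‖B‖) := by
      refine (norm_sub_le _ _).trans ?_
      rw [norm_smul, norm_smul, hnI η hη, hnI η' hη']
      gcongr
      · exact hbound η hη hs
      · exact hbound η' hη' hs'
    calc _ ≤ _ := h1
      _ ≤ 2 * c * (η * (4 * c * ‖B‖) + η' * (4 * c * ‖B‖)) := by gcongr
      _ = _ := by ring
  refine cauchy_map_iff_exists_tendsto.1 (cauchy_map_iff.2 ⟨inferInstance, ?_⟩)
  rw [Metric.uniformity_basis_dist.tendsto_right_iff]
  intro ε hε
  have hsmall : ∀ᶠ η : ℝ in 𝓝[>] 0, 0 < η ∧ 4 * c * η ≤ 1 ∧ 8 * c ^ 2 * ‖B‖ * η < ε / 2 := by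
    have t1 : Tendsto (fun η : ℝ => 4 * c * η) (𝓝[>] 0) (𝓝 0) := by
      have : Tendsto (fun η : ℝ => 4 * c * η) (𝓝 0) (𝓝 (4 * c * 0)) :=
        (continuous_const.mul continuous_id).tendsto 0
      rw [mul_zero] at this
      exact this.mono_left nhdsWithin_le_nhds
    have t2 : Tendsto (fun η : ℝ => 8 * c ^ 2 * ‖B‖ * η) (𝓝[>] 0) (𝓝 0) := by
      have : Tendsto (fun η : ℝ => 8 * c ^ 2 * ‖B‖ * η) (𝓝 0) (𝓝 (8 * c ^ 2 * ‖B‖ * 0)) :=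
        (continuous_const.mul continuous_id).tendsto 0
      rw [mul_zero] at this
      exact this.mono_left nhdsWithin_le_nhds
    filter_upwards [self_mem_nhdsWithin, t1.eventually (ge_mem_nhds zero_lt_one),
      t2.eventually (gt_mem_nhds (half_pos hε))] with η h1 h2 h3
    exact ⟨h1, h2, h3⟩
  filter_upwards [hsmall.prod_mk hsmall] with x hx
  obtain ⟨⟨h1, h2, h3⟩, h4, h5, h6⟩ := hx
  rw [dist_eq_norm]
  refine (hdiff _ _ h1 h4 h2 h5).trans_lt ?_
  rw [mul_add]
  linarith

end CStar

/-! ### Periodic operators and the trace per unit volume -/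

lemma spinOp_delta (g : Site ≃ Site) (M : Matrix Spin Spin ℂ) (q : Site × Spin) :
    spinOp g M (delta q) = ∑ s, M s q.2 • delta (g q.1, s) := by
  refine Hil.ext fun p => ?_
  have h : (∑ s, M s q.2 • delta (g q.1, s)) p = ∑ s, M s q.2 * delta (g q.1, s) p := by
    rw [← evalAt_apply, map_sum]
    simp [evalAt_apply]
  obtain ⟨x, t⟩ := p
  obtain ⟨y, u⟩ := q
  rw [h, spinOp_apply]
  simp only [delta_apply, Prod.mk.injEq, Equiv.symm_apply_eq]
  by_cases hxy : x = g y <;> simp [hxy]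

lemma spinOp_mul_entry (g : Site ≃ Site) (M : Matrix Spin Spin ℂ) (A : Op) (p q : Site × Spin) :
    (spinOp g M * A) (delta q) p = ∑ s, M p.2 s * A (delta q) (g.symm p.1, s) := rfl

lemma mul_spinOp_entry (g : Site ≃ Site) (M : Matrix Spin Spin ℂ) (A : Op) (p q : Site × Spin) :
    (A * spinOp g M) (delta q) p = ∑ s, M s q.2 * A (delta (g q.1, s)) p := by
  rw [mul_entry, spinOp_delta, map_sum, ← evalAt_apply, map_sum]
  simp [evalAt_apply]

lemma spinOp_mul_spinOp (g : Site ≃ Site) (M N : Matrix Spin Spin ℂ) :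
    spinOp g M * spinOp (Equiv.refl Site) N = spinOp g (M * N) := by
  refine ContinuousLinearMap.ext fun ψ => Hil.ext fun p => ?_
  change ∑ s, M p.2 s * ∑ t, N s t * ψ (g.symm p.1, t) = ∑ t, (M * N) p.2 t * ψ (g.symm p.1, t)
  simp only [Matrix.mul_apply, Finset.mul_sum, Finset.sum_mul]
  rw [Finset.sum_comm]
  simp only [mul_assoc]

lemma spinOp_refl_mul_spinOp (g : Site ≃ Site) (M N : Matrix Spin Spin ℂ) :
    spinOp (Equiv.refl Site) N * spinOp g M = spinOp g (N * M) := by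
  refine ContinuousLinearMap.ext fun ψ => Hil.ext fun p => ?_
  change ∑ s, N p.2 s * ∑ t, M s t * ψ (g.symm p.1, t) = ∑ t, (N * M) p.2 t * ψ (g.symm p.1, t)
  simp only [Matrix.mul_apply, Finset.mul_sum, Finset.sum_mul]
  rw [Finset.sum_comm]
  simp only [mul_assoc]

lemma IsPeriodic.entry {A : Op} (h : IsPeriodic A) (n : ℤ × ℤ) (p q : Site × Spin) :
    A (delta (translateSite n q.1, q.2)) (translateSite n p.1, p.2) = A (delta q) p := by
  have h1 : (A * translation n) (delta q) (translateSite n p.1, p.2) =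
      (translation n * A) (delta q) (translateSite n p.1, p.2) := by rw [h n]
  rw [translation, mul_spinOp_entry, spinOp_mul_entry] at h1
  simpa [Matrix.one_apply] using h1

/-- The algebra of periodic bounded operators. -/
def periodicOps : Subalgebra ℂ Op := Subalgebra.centralizer ℂ (Set.range translation)

lemma mem_periodicOps {A : Op} : A ∈ periodicOps ↔ IsPeriodic A := by
  rw [periodicOps, Subalgebra.mem_centralizer_iff]
  simp only [Set.forall_mem_range]
  exact ⟨fun h n => (h n).symm, fun h n => (h n).symm⟩

lemma spinOp_refl_isPeriodic (M : Matrix Spin Spin ℂ) :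
    IsPeriodic (spinOp (Equiv.refl Site) M) := fun n => by
  rw [translation, spinOp_refl_mul_spinOp, spinOp_mul_spinOp, mul_one, one_mul]

lemma isClosed_periodicOps : IsClosed (periodicOps : Set Op) :=
  Set.isClosed_centralizer _

/-- The trace per unit volume of a periodic bounded operator, computed in one cell. -/
def cellTrace : Op →ₗ[ℂ] ℂ where
  -- The normalization counts sites, two per cell; spin is not counted.
  toFun A := (1 / 2 : ℂ) * ∑ a : Fin 2 × Spin,
    A (delta (((0 : ℤ × ℤ), a.1), a.2)) (((0 : ℤ × ℤ), a.1), a.2)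
  map_add' A B := by
    simp only [add_apply, Hil.add_apply, Finset.sum_add_distrib, mul_add]
  map_smul' c A := by
    simp only [smul_apply, Hil.smul_apply, ← Finset.mul_sum, RingHom.id_apply,
      smul_eq_mul]
    ring

lemma cellTrace_apply (A : Op) : cellTrace A = (1 / 2 : ℂ) * ∑ a : Fin 2 × Spin,
    A (delta (((0 : ℤ × ℤ), a.1), a.2)) (((0 : ℤ × ℤ), a.1), a.2) := rfl

lemma tendsto_cellTrace {ι : Type*} {l : Filter ι} {F : ι → Op} {A : Op}
    (h : Tendsto F l (𝓝 A)) : Tendsto (fun n => cellTrace (F n)) l (𝓝 (cellTrace A)) :=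
  (tendsto_finsetSum _ fun _ _ => tendsto_entry h _ _).const_mul _

lemma cellTrace_star (A : Op) : cellTrace (star A) = star (cellTrace A) := by
  simp only [cellTrace_apply, star_entry, star_mul', star_sum]
  simp

/-- The trace per unit volume is cyclic on periodic operators. -/
lemma cellTrace_mul_comm {A B : Op} (hA : IsPeriodic A) (hB : IsPeriodic B) :
    cellTrace (A * B) = cellTrace (B * A) := by
  have hsum : ∀ {A B : Op} (a : Fin 2 × Spin),
      HasSum (fun r : (Fin 2 × Spin) × (ℤ × ℤ) =>
        A (delta ((r.2, r.1.1), r.1.2)) (((0 : ℤ × ℤ), a.1), a.2) *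
          B (delta (((0 : ℤ × ℤ), a.1), a.2)) ((r.2, r.1.1), r.1.2))
        ((A * B) (delta (((0 : ℤ × ℤ), a.1), a.2)) (((0 : ℤ × ℤ), a.1), a.2)) := by
    intro A B a
    let e : (Fin 2 × Spin) × (ℤ × ℤ) ≃ Site × Spin :=
      { toFun := fun r => ((r.2, r.1.1), r.1.2)
        invFun := fun q => ((q.1.2, q.2), q.1.1)
        left_inv := fun _ => rfl
        right_inv := fun _ => rfl }
    exact (Equiv.hasSum_iff e).2 (hasSum_mul_entry A B (((0 : ℤ × ℤ), a.1), a.2) _)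
  let F : Op → Op → (Fin 2 × Spin) → (Fin 2 × Spin) → ℤ × ℤ → ℂ := fun A B a b m =>
    A (delta ((m, b.1), b.2)) (((0 : ℤ × ℤ), a.1), a.2) *
      B (delta (((0 : ℤ × ℤ), a.1), a.2)) ((m, b.1), b.2)
  have htr : ∀ A B : Op, cellTrace (A * B) =
      (1 / 2 : ℂ) * ∑ a : Fin 2 × Spin, ∑ b : Fin 2 × Spin, ∑' m, F A B a b m := by
    intro A B
    rw [cellTrace_apply]
    congr 1
    refine Finset.sum_congr rfl fun a _ => ?_
    rw [← (hsum a).tsum_eq, (hsum a).summable.tsum_prod, tsum_fintype]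
  -- Translation by `-m` carries the pair of cells `(0, m)` to `(-m, 0)`, exchanging the roles of
  -- `A` and `B`.
  have hflip : ∀ a b m, F A B a b m = F B A b a (-m) := by
    intro a b m
    have h1 := hA.entry (-m) (((0 : ℤ × ℤ), a.1), a.2) ((m, b.1), b.2)
    have h2 := hB.entry (-m) ((m, b.1), b.2) (((0 : ℤ × ℤ), a.1), a.2)
    simp only [translateSite, Equiv.coe_fn_mk, zero_add, add_neg_cancel] at h1 h2
    simp only [F]
    rw [← h1, ← h2, mul_comm]
  rw [htr, htr, Finset.sum_comm]
  congr 1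
  refine Finset.sum_congr rfl fun b _ => Finset.sum_congr rfl fun a _ => ?_
  simp only [hflip]
  exact (Equiv.neg (ℤ × ℤ)).tsum_eq (F B A b a)

/-- Only the spin sum at each site has to agree with that of a periodic operator; `A` itself may be
unbounded and non-periodic, as the proper current is. Each finite-volume average then already equals
the limit. -/
lemma hasTracePUV_of_sum_spin {A : UOp} {B : Op} (hB : IsPeriodic B) (h : ∀ p, delta p ∈ A.domain)
    (heq : ∀ x : Site, ∑ s : Spin, inner ℂ (delta (x, s)) (A ⟨delta (x, s), h _⟩) =
      ∑ s : Spin, B (delta (x, s)) (x, s)) : HasTracePUV A (cellTrace B) := by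
  refine ⟨h, tendsto_const_nhds.congr fun k => ?_⟩
  have h0 : ∀ (n : ℤ × ℤ) (a : Fin 2) (s : Spin), B (delta ((n, a), s)) ((n, a), s) =
      B (delta ((0, a), s)) ((0, a), s) := by
    intro n a s
    have := hB.entry n ((0, a), s) ((0, a), s)
    simpa [translateSite] using this
  rw [Finset.sum_product]
  simp only [heq]
  rw [cell, Finset.sum_product]
  simp only [h0]
  rw [Finset.sum_const, Finset.card_product, Finset.card_product, Int.card_Icc, nsmul_eq_mul,
    cellTrace_apply, Fintype.sum_prod_type]
  have hk : ((k : ℤ) + 1 - -(k : ℤ)).toNat = 2 * k + 1 := by omega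
  rw [hk]
  have hk0 : ((2 * k + 1 : ℕ) : ℂ) ≠ 0 := Nat.cast_ne_zero.2 (Nat.succ_ne_zero (2 * k))
  simp only [Finset.card_univ, Fintype.card_fin]
  push_cast at hk0 ⊢
  field_simp

lemma HasTracePUV.unique {A : UOp} {t t' : ℂ} (h : HasTracePUV A t) (h' : HasTracePUV A t') :
    t = t' :=
  tendsto_nhds_unique h.2 h'.2

lemma HasTracePUV.exists {A : UOp} {t : ℂ} (h : HasTracePUV A t) : TracePUVExists A := ⟨t, h⟩

lemma HasTracePUV.tau_eq {A : UOp} {t : ℂ} (h : HasTracePUV A t) : tau A = t := by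
  rw [tau, dif_pos h.exists]
  exact h.exists.choose_spec.unique h

lemma IsPeriodic.hasTracePUV {A : Op} (h : IsPeriodic A) : HasTracePUV (toU A) (cellTrace A) :=
  hasTracePUV_of_sum_spin h (fun _ => mem_toU_domain A _) fun x =>
    Finset.sum_congr rfl fun s _ => by rw [inner_delta_left]; rfl

lemma IsPeriodic.hasTracePUV_prodU {A B : Op} (h : IsPeriodic (A * B)) :
    HasTracePUV (prodU (toU A) (toU B)) (cellTrace (A * B)) := by
  have hd : ∀ ψ, ψ ∈ (prodU (toU A) (toU B)).domain := fun ψ =>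
    (mem_prodU_domain _ _ _).2 ⟨mem_toU_domain _ _, mem_toU_domain _ _⟩
  exact hasTracePUV_of_sum_spin h (fun _ => hd _) fun x =>
    Finset.sum_congr rfl fun s _ => by rw [inner_delta_left]; rfl

/-! ### Lattice symmetries -/

/-- Commutators with the position operators transform as a vector under a lattice symmetry. -/
lemma kernelComm_mul_spinOp {g : Site ≃ Site} {M : Matrix Spin Spin ℂ} {A : Op} {D : Fin 2 → Op}
    (hD : ∀ k, IsKernelComm (pos · k) A (D k)) (hA : A * spinOp g M = spinOp g M * A)
    {c : Fin 2 → Fin 2 → ℝ}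
    (hg : ∀ x y j, pos (g x) j - pos (g y) j = ∑ k, c j k * (pos x k - pos y k)) (j : Fin 2) :
    D j * spinOp g M = spinOp g M * ∑ k, (c j k : ℂ) • D k := by
  refine op_ext fun p q => ?_
  obtain ⟨x, u, rfl⟩ : ∃ x u, p = (g x, u) := ⟨g.symm p.1, p.2, by simp⟩
  have h1 : (A * spinOp g M) (delta q) (g x, u) = (spinOp g M * A) (delta q) (g x, u) := by
    rw [hA]
  rw [mul_spinOp_entry, spinOp_mul_entry] at h1
  rw [mul_spinOp_entry, spinOp_mul_entry]
  have h2 : ∀ s, (∑ k, (c j k : ℂ) • D k) (delta q) (x, s) =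
      ((pos (g x) j : ℂ) - (pos (g q.1) j : ℂ)) * A (delta q) (x, s) := by
    intro s
    rw [← Complex.ofReal_sub, hg]
    simp only [Fin.sum_univ_two, add_apply, smul_apply,
      Hil.add_apply, Hil.smul_apply, hD _ (x, s) q]
    push_cast
    ring
  have h3 : ∀ s, D j (delta (g q.1, s)) (g x, u) =
      ((pos (g x) j : ℂ) - (pos (g q.1) j : ℂ)) * A (delta (g q.1, s)) (g x, u) := fun s =>
    hD j _ _
  simp only [Equiv.symm_apply_apply] at h1 ⊢
  simp only [h2, h3]
  calc _ = ((pos (g x) j : ℂ) - (pos (g q.1) j : ℂ)) *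
        ∑ s, M s q.2 * A (delta (g q.1, s)) (g x, u) := by
        rw [Finset.mul_sum]
        exact Finset.sum_congr rfl fun s _ => by ring
    _ = _ := by
      rw [h1, Finset.mul_sum]
      exact Finset.sum_congr rfl fun s _ => by ring

/-- Commutators of periodic operators with the position operators are periodic. -/
lemma IsKernelComm.isPeriodic {A : Op} {i : Fin 2} {B : Op} (h : IsKernelComm (pos · i) A B)
    (hA : IsPeriodic A) : IsPeriodic B := fun n => by
  refine op_ext fun p q => ?_
  obtain ⟨x, u, rfl⟩ : ∃ x u, p = (translateSite n x, u) :=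
    ⟨(translateSite n).symm p.1, p.2, by simp⟩
  have h1 := hA.entry n (x, u) q
  rw [translation, mul_spinOp_entry, spinOp_mul_entry]
  simp only [Matrix.one_apply, ite_mul, one_mul, zero_mul, Finset.sum_ite_eq, Finset.sum_ite_eq',
    Finset.mem_univ, if_true, Equiv.symm_apply_apply]
  rw [h, h, ← h1]
  simp only [pos_translateSite, Pi.add_apply]
  push_cast
  ring

/-! ### Spin traces and the threefold rotation -/

/-- The spin trace of the block of `A` at the site `x`. -/
def spinTrace (A : Op) (x : Site) : ℂ := ∑ s : Spin, A (delta (x, s)) (x, s)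

lemma spinTrace_add (A B : Op) (x : Site) : spinTrace (A + B) x = spinTrace A x + spinTrace B x := by
  simp [spinTrace, Finset.sum_add_distrib]

lemma spinTrace_smul (c : ℂ) (A : Op) (x : Site) : spinTrace (c • A) x = c * spinTrace A x := by
  simp [spinTrace, mul_add]

lemma IsPeriodic.spinTrace_eq {A : Op} (h : IsPeriodic A) (m n : ℤ × ℤ) (a : Fin 2) :
    spinTrace A (m, a) = spinTrace A (n, a) := by
  refine Finset.sum_congr rfl fun s _ => ?_
  have := h.entry (m - n) ((n, a), s) ((n, a), s)
  simpa [translateSite] using this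

/-- The spin trace is covariant under lattice symmetries. -/
lemma spinTrace_symm {g : Site ≃ Site} {M : Matrix Spin Spin ℂ} (hM : IsUnit M) {A B : Op}
    (h : A * spinOp g M = spinOp g M * B) (x : Site) : spinTrace A (g x) = spinTrace B x := by
  let A' : Matrix Spin Spin ℂ := fun s t => A (delta (g x, t)) (g x, s)
  let B' : Matrix Spin Spin ℂ := fun s t => B (delta (x, t)) (x, s)
  have h1 : A' * M = M * B' := by
    ext s t
    have h2 : (A * spinOp g M) (delta (x, t)) (g x, s) =
        (spinOp g M * B) (delta (x, t)) (g x, s) := by rw [h]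
    rw [mul_spinOp_entry, spinOp_mul_entry] at h2
    simp only [Equiv.symm_apply_apply] at h2
    rw [Matrix.mul_apply, Matrix.mul_apply, ← h2]
    exact Finset.sum_congr rfl fun u _ => mul_comm _ _
  obtain ⟨u, rfl⟩ := hM
  change A'.trace = B'.trace
  have h2 : A' = u * B' * (↑u⁻¹ : Matrix Spin Spin ℂ) := by
    rw [← h1, mul_assoc, Units.mul_inv, mul_one]
  rw [h2, Matrix.trace_mul_comm, ← mul_assoc, Units.inv_mul, one_mul]

/-- The matrix of the rotation of the plane by `2π/3`. -/
def rotCoeff : Fin 2 → Fin 2 → ℝ := ![![-(1 / 2), -(√3 / 2)], ![√3 / 2, -(1 / 2)]]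

lemma pos_rotSite_sub (x y : Site) (j : Fin 2) :
    pos (rotSite x) j - pos (rotSite y) j = ∑ k, rotCoeff j k * (pos x k - pos y k) := by
  rw [pos_rotSite, pos_rotSite, Fin.sum_univ_two]
  fin_cases j <;> simp [rotVec, rotCoeff] <;> ring

/-- A family of periodic operators that transforms as a vector under the rotation has vanishing
spin traces. -/
lemma spinTrace_eq_zero_of_rotation {A : Fin 2 → Op} (hA : ∀ j, IsPeriodic (A j))
    (h : ∀ j, A j * rotation = rotation * ∑ k, (rotCoeff j k : ℂ) • A k) (j : Fin 2) (x : Site) :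
    spinTrace (A j) x = 0 := by
  -- The rotation preserves the sublattice, so by periodicity the spin traces at `x` and at its
  -- image agree. The pair of traces is thus fixed by the rotation matrix, which does not have
  -- eigenvalue one.
  have key : ∀ j, spinTrace (A j) x =
      rotCoeff j 0 * spinTrace (A 0) x + rotCoeff j 1 * spinTrace (A 1) x := by
    intro j
    have h1 := spinTrace_symm (Matrix.isUnit_exp _) (h j) x
    rw [Fin.sum_univ_two, spinTrace_add, spinTrace_smul, spinTrace_smul] at h1
    rw [← h1]
    exact (hA j).spinTrace_eq _ _ _
  have h0 := key 0
  have h1 := key 1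
  have h3 : ((√3 : ℝ) : ℂ) * ((√3 : ℝ) : ℂ) = 3 := by
    rw [← Complex.ofReal_mul, Real.mul_self_sqrt (by norm_num)]
    norm_num
  simp only [rotCoeff, Matrix.cons_val_zero, Matrix.cons_val_one] at h0 h1
  push_cast at h0 h1
  have e0 : spinTrace (A 0) x = 0 := by
    linear_combination (1 / 2 : ℂ) * h0 - ((√3 : ℝ) : ℂ) / 6 * h1 -
      (1 / 12 : ℂ) * spinTrace (A 0) x * h3
  have e1 : spinTrace (A 1) x = 0 := by
    rw [e0] at h1
    linear_combination (2 / 3 : ℂ) * h1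
  fin_cases j
  · exact e0
  · exact e1

lemma Sz_commute_rotation : Sz * rotation = rotation * Sz := by
  rw [Sz, rotation, spinOp_refl_mul_spinOp, spinOp_mul_spinOp]
  congr 1
  exact (((Commute.refl ((1 / 2 : ℂ) • sigmaZ)).smul_left _).exp_left).symm.eq

lemma Sz_isPeriodic : IsPeriodic Sz := spinOp_refl_isPeriodic _

lemma Sz_isSelfAdjoint : IsSelfAdjoint Sz := by
  refine op_ext fun p q => ?_
  rw [star_entry, Sz, spinOp_apply, spinOp_apply]
  obtain ⟨x, s⟩ := p
  obtain ⟨y, t⟩ := q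
  by_cases h : x = y
  · subst h
    fin_cases s <;> fin_cases t <;> simp [delta_apply, sigmaZ]
  · simp [delta_apply, h, Ne.symm h]

/-- The spin operator commutes with the position operators. -/
lemma isKernelComm_Sz (f : Site → ℝ) : IsKernelComm f Sz 0 := fun p q => by
  rw [Sz, spinOp_apply]
  obtain ⟨x, s⟩ := p
  obtain ⟨y, t⟩ := q
  by_cases h : x = y
  · simp [h]
  · simp [delta_apply, h]

/-! ### An algebraic identity for tracial functionals -/

section Tracial

variable {R M : Type*} [Ring R] [AddCommGroup M] {τ : R →+ M} {P : R}

/-- With respect to `P`, a diagonal operator times an off-diagonal one is off-diagonal, and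
cyclicity kills the trace of each corner. -/
lemma tracial_mul_eq_zero (hτ : ∀ x y, τ (x * y) = τ (y * x)) (hP : P * P = P) {x l : R}
    (hx : x * P = P * x) (hl : l * P + P * l = l) : τ (x * l) = 0 := by
  have hPlP : P * l * P = 0 := by
    have h1 : P * (l * P + P * l) = P * l := by rw [hl]
    rw [mul_add, ← mul_assoc, ← mul_assoc, hP] at h1
    simpa using h1
  have h1 : τ (x * (P * l)) = 0 := by
    have e1 : x * (P * l) = P * (x * P * l) := by
      calc x * (P * l) = x * ((P * P) * l) := by rw [hP]
        _ = (x * P) * (P * l) := by noncomm_ring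
        _ = (P * x) * (P * l) := by rw [hx]
        _ = _ := by noncomm_ring
    have e2 : x * P * l * P = 0 := by
      calc x * P * l * P = x * (P * l * P) := by noncomm_ring
        _ = 0 := by rw [hPlP, mul_zero]
    rw [e1, hτ, e2, map_zero]
  have h2 : τ (x * (l * P)) = 0 := by
    rw [← mul_assoc, hτ, ← mul_assoc, ← hx, mul_assoc, h1]
  rw [← hl, mul_add, map_add, h1, h2, add_zero]

/-- Products of two off-diagonal elements are diagonal: each factor exchanges the two blocks. -/
lemma mul_comm_of_offDiag {x y : R} (hx : x * P + P * x = x) (hy : y * P + P * y = y) :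
    x * y * P = P * (x * y) := by
  have h1 : x * (y * P + P * y) = x * y := by rw [hy]
  have h2 : (x * P + P * x) * y = x * y := by rw [hx]
  have h3 : x * y * P + x * P * y = x * P * y + P * (x * y) := by
    rw [mul_add, ← mul_assoc, ← mul_assoc] at h1
    rw [add_mul, mul_assoc P] at h2
    rw [h1, h2]
  rw [add_comm] at h3
  exact add_left_cancel h3

/-- The double commutator `[[x, P], P]` equals `x P - 2 P x P + P x`, which is the off-diagonal part
of `x`. -/
lemma offDiag_doubleComm (hP : P * P = P) (x : R) :
    ((x * P - P * x) * P - P * (x * P - P * x)) * P +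
      P * ((x * P - P * x) * P - P * (x * P - P * x)) =
      (x * P - P * x) * P - P * (x * P - P * x) := by
  have h : (x * P - P * x) * P - P * (x * P - P * x) = x * P - 2 • (P * x * P) + P * x := by
    calc _ = x * (P * P) - 2 • (P * x * P) + (P * P) * x := by noncomm_ring
      _ = _ := by rw [hP]
  rw [h]
  calc _ = x * (P * P) - 2 • (P * x * (P * P)) + 2 • (P * x * P) - 2 • ((P * P) * x * P)
        + (P * P) * x := by noncomm_ring
    _ = _ := by rw [hP]; abel

lemma comm_sub_doubleComm (hP : P * P = P) (x : R) :
    (x - ((x * P - P * x) * P - P * (x * P - P * x))) * P =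
      P * (x - ((x * P - P * x) * P - P * (x * P - P * x))) := by
  have h : x - ((x * P - P * x) * P - P * (x * P - P * x)) =
      x - x * P + 2 • (P * x * P) - P * x := by
    calc _ = x - x * (P * P) + 2 • (P * x * P) - (P * P) * x := by noncomm_ring
      _ = _ := by rw [hP]
  rw [h]
  calc _ = x * P - x * (P * P) + 2 • (P * x * (P * P)) - P * x * P := by noncomm_ring
    _ = P * x - P * x * P + 2 • ((P * P) * x * P) - (P * P) * x := by rw [hP]; abel
    _ = _ := by noncomm_ring

/-- The decomposition of the linear response of the current `c s` into its spin-commuting and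
spin-noncommuting parts. -/
lemma tracial_decomposition (hτ : ∀ x y, τ (x * y) = τ (y * x)) (hP : P * P = P)
    {h s c a b l : R} (hh : h * P = P * h) (ha : a * P + P * a = a) (hb : b * P + P * b = b)
    (hl : l * P + P * l = l) (hlb : h * l - l * h = b)
    (hca : c * P - P * c = h * a - a * h) :
    τ (c * s * l) = τ (s * P * (a * b - b * a)) +
      τ (c * ((s * P - P * s) * P - P * (s * P - P * s)) * l +
        (a * P - P * a) * (s * h - h * s) * l + P * a * (s * b - b * s)) := by
  set o := (s * P - P * s) * P - P * (s * P - P * s) with ho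
  set y := a * P - P * a with hy
  have hoff : o * P + P * o = o := offDiag_doubleComm hP s
  have hdiag : (s - o) * P = P * (s - o) := comm_sub_doubleComm hP s
  have hyoff : y * P + P * y = y := by
    have e : y * P + P * y = a * (P * P) - (P * P) * a := by rw [hy]; noncomm_ring
    rw [e, hP]
  -- The off-diagonal part of `c` is `[h, y]`, because `[c, P] = [h, a]` and `h` commutes with `P`.
  have hcoff : (c * P - P * c) * P - P * (c * P - P * c) = h * y - y * h := by
    rw [hca]
    calc _ = h * (a * P) - a * (h * P) - (P * h) * a + P * a * h := by noncomm_ring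
      _ = h * (a * P) - a * (P * h) - (h * P) * a + P * a * h := by rw [hh]
      _ = _ := by rw [hy]; noncomm_ring
  have hcdiag : (c - (h * y - y * h)) * P = P * (c - (h * y - y * h)) := by
    rw [← hcoff]; exact comm_sub_doubleComm hP c
  have hohoff : (o * h - h * o) * P + P * (o * h - h * o) = o * h - h * o := by
    calc _ = o * (h * P) - h * (o * P) + P * o * h - (P * h) * o := by noncomm_ring
      _ = o * (P * h) - h * (o * P) + P * o * h - (h * P) * o := by rw [hh]
      _ = (o * P + P * o) * h - h * (o * P + P * o) := by noncomm_ring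
      _ = _ := by rw [hoff]
  have z1 : τ ((c - (h * y - y * h)) * (s - o) * l) = 0 := by
    refine tracial_mul_eq_zero hτ hP ?_ hl
    rw [mul_assoc, hdiag, ← mul_assoc, hcdiag, mul_assoc]
  have z2 : τ (y * (o * h - h * o) * l) = 0 :=
    tracial_mul_eq_zero hτ hP (mul_comm_of_offDiag hyoff hohoff) hl
  have z3 : τ (y * o * b) = 0 :=
    tracial_mul_eq_zero hτ hP (mul_comm_of_offDiag hyoff hoff) hb
  -- Integration by parts: cyclicity moves `h` to the far right, and commuting it past `l` costs
  -- `b`. By `z2` and `z3`, `s - o` may be replaced by `s` in the result.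
  have e1 : τ ((h * y - y * h) * (s - o) * l) =
      τ (y * (s * h - h * s) * l) - τ (y * s * b) := by
    have e2 : τ (h * (y * (s - o) * l)) = τ (y * (s - o) * l * h) := hτ _ _
    have e3 : y * (s - o) * l * h = y * (s - o) * h * l - y * (s - o) * b := by
      rw [← hlb]; noncomm_ring
    have e4 : (h * y - y * h) * (s - o) * l =
        h * (y * (s - o) * l) - y * h * (s - o) * l := by noncomm_ring
    rw [e4, map_sub, e2, e3, map_sub]
    have e5 : y * (s - o) * h * l = y * (s * h - h * s) * l - y * (o * h - h * o) * l +
        y * h * (s - o) * l := by noncomm_ring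
    have e6 : y * (s - o) * b = y * s * b - y * o * b := by noncomm_ring
    rw [e5, e6, map_add, map_sub, map_sub, z2, z3]
    abel
  have e7 : c * s * l = c * o * l + ((c - (h * y - y * h)) * (s - o) * l +
      (h * y - y * h) * (s - o) * l) := by noncomm_ring
  have e8 : -τ (y * s * b) = τ (s * P * (a * b - b * a)) + τ (P * a * (s * b - b * s)) := by
    have f1 : y * s * b = a * (P * s * b) - P * a * s * b := by rw [hy]; noncomm_ring
    have f2 : s * P * (a * b - b * a) = s * (P * a * b) - s * (P * (b * a)) := by noncomm_ring
    have f3 : P * a * (s * b - b * s) = P * a * s * b - P * a * b * s := by noncomm_ring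
    -- After cyclic rotation, `P` has to pass `b a`, which is diagonal.
    have f4 : τ (a * (P * s * b)) = τ (s * (P * (b * a))) := by
      rw [hτ, ← mul_comm_of_offDiag hb ha, ← mul_assoc s, hτ (s * (b * a)) P]
      congr 1
      noncomm_ring
    rw [f1, f2, f3, map_sub, map_sub, map_sub, f4, hτ s (P * a * b)]
    abel
  rw [e7, map_add, map_add, z1, e1, zero_add, map_add, map_add]
  rw [sub_eq_add_neg, e8]
  abel

end Tracial

/-! ### Bounded commutators with the position operators -/

lemma IsPosLipschitz.of_forall {i : Fin 2} {A : Op} {C : ℝ}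
    (h : ∀ (n : ℕ) (F : Op), (∀ B, IsKernelComm (truncPos i n) B (F * B - B * F)) →
      ‖F * A - A * F‖ ≤ C) : IsPosLipschitz i A := by
  refine ⟨C, fun n B hB => ?_⟩
  obtain ⟨F, hF⟩ := exists_isKernelComm_truncPos i n
  rw [hB.unique (hF A)]
  exact h n F hF

lemma norm_comm_le (A B : Op) : ‖A * B - B * A‖ ≤ 2 * (‖A‖ * ‖B‖) := by
  refine (norm_sub_le _ _).trans ?_
  have h1 := norm_mul_le A B
  have h2 := norm_mul_le B A
  linarith

/-- For a truncated coordinate `F`, `[F, P]` is off-diagonal and `[H, [F, P]] = [P, [F, H]]` is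
bounded uniformly in the height, so the gap estimate applies. -/
lemma isPosLipschitz_lowerProj {H : Op} (hH : IsSelfAdjoint H) {μ : ℝ} (hμ : μ ∉ spectrum ℝ H)
    {i : Fin 2} (hHi : IsPosLipschitz i H) : IsPosLipschitz i (lowerProj H μ) := by
  obtain ⟨c, hc, hoff⟩ := exists_norm_le_of_offDiag hH hμ
  obtain ⟨C, hC⟩ := hHi
  set P := lowerProj H μ with hPdef
  have hPP : P * P = P := lowerProj_mul_self hH hμ
  have hPH : P * H = H * P := (lowerProj_comm H μ).eq
  refine IsPosLipschitz.of_forall (C := 2 * c * (2 * (C * ‖P‖))) fun n F hF => ?_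
  have h1 := hoff (F * P - P * F) (by
    calc _ = F * (P * P) - (P * P) * F := by noncomm_ring
      _ = _ := by rw [hPP])
  have h2 : H * (F * P - P * F) - (F * P - P * F) * H =
      P * (F * H - H * F) - (F * H - H * F) * P := by
    calc _ = H * F * P - (H * P) * F - F * (P * H) + P * F * H := by noncomm_ring
      _ = H * F * P - (P * H) * F - F * (H * P) + P * F * H := by rw [hPH]
      _ = _ := by noncomm_ring
  rw [h2] at h1
  have h3 := norm_comm_le P (F * H - H * F)
  have h4 := hC n _ (hF H)
  refine h1.trans ?_
  gcongr
  refine h3.trans ?_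
  rw [mul_comm ‖P‖]
  gcongr

/-- Applied with `D = [X_j, P]` and `E = [X_j, H]`, this bounds the second commutator `[X_i, [X_j,
P]]`. For `Q = [F, D]`, differentiating `D P + P D = D` controls the diagonal corners by `Z = D [F,
P] + [F, P] D`; the gap estimate controls the other two. -/
lemma isPosLipschitz_comm_lowerProj {H : Op} (hH : IsSelfAdjoint H) {μ : ℝ}
    (hμ : μ ∉ spectrum ℝ H) {i : Fin 2} (hHi : IsPosLipschitz i H) {D E : Op}
    (hD : D * lowerProj H μ + lowerProj H μ * D = D)
    (hDE : H * D - D * H = lowerProj H μ * E - E * lowerProj H μ) (hE : IsPosLipschitz i E) :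
    IsPosLipschitz i D := by
  obtain ⟨c, hc, hcor⟩ := exists_norm_corner_le hH hμ
  obtain ⟨C₁, hC₁⟩ := isPosLipschitz_lowerProj hH hμ hHi
  obtain ⟨C₀, hC₀⟩ := hHi
  obtain ⟨C₂, hC₂⟩ := hE
  set P := lowerProj H μ with hPdef
  have hPP : P * P = P := lowerProj_mul_self hH hμ
  set N := 1 - P with hN
  have hPN : P * N = 0 := by rw [hN, mul_sub, mul_one, hPP, sub_self]
  have hNP : N * P = 0 := by rw [hN, sub_mul, one_mul, hPP, sub_self]
  set z := 2 * (‖D‖ * C₁) with hz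
  set w := 2 * (C₁ * ‖E‖) + 2 * (‖P‖ * C₂) + 2 * (C₀ * ‖D‖) with hw
  refine IsPosLipschitz.of_forall (C := ‖P‖ * z * ‖P‖ + ‖N‖ * z * ‖N‖ + (c * w + c * w))
    fun n F hF => ?_
  set Q := F * D - D * F with hQ
  set G := F * P - P * F with hG
  set K := F * H - H * F with hK
  set S := F * E - E * F with hS
  have hGn : ‖G‖ ≤ C₁ := hC₁ n _ (hF P)
  have hKn : ‖K‖ ≤ C₀ := hC₀ n _ (hF H)
  have hSn : ‖S‖ ≤ C₂ := hC₂ n _ (hF E)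
  set Z := D * G + G * D with hZ
  have hZn : ‖Z‖ ≤ z := by
    refine (norm_add_le _ _).trans ?_
    have h1 : ‖D * G‖ ≤ ‖D‖ * C₁ := (norm_mul_le _ _).trans (by gcongr)
    have h2 : ‖G * D‖ ≤ C₁ * ‖D‖ := (norm_mul_le _ _).trans (by gcongr)
    rw [hz]
    linarith
  have hQdec : Q = Q * P + P * Q + Z := by
    have : F * (D * P + P * D) - (D * P + P * D) * F = Q * P + P * Q + Z := by
      rw [hQ, hZ, hG]; noncomm_ring
    rw [← this, hD]
  have hPQP : P * Q * P = -(P * Z * P) := by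
    have h1 : P * Q * P = P * (Q * P + P * Q + Z) * P := by rw [← hQdec]
    have h2 : P * (Q * P + P * Q + Z) * P =
        P * Q * (P * P) + (P * P) * Q * P + P * Z * P := by noncomm_ring
    rw [h2, hPP] at h1
    have h3 : P * Q * P + (P * Q * P + P * Z * P) = P * Q * P + 0 := by
      rw [add_zero, ← add_assoc]; exact h1.symm
    exact eq_neg_of_add_eq_zero_left (add_left_cancel h3)
  have hNQN : N * Q * N = N * Z * N := by
    have h1 : N * Q * N = N * (Q * P + P * Q + Z) * N := by rw [← hQdec]
    have h2 : N * (Q * P + P * Q + Z) * N =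
        N * Q * (P * N) + (N * P) * Q * N + N * Z * N := by noncomm_ring
    rw [h2, hPN, hNP] at h1
    simpa using h1
  have hcomm : H * Q - Q * H = (G * E - E * G) + (P * S - S * P) - (K * D - D * K) := by
    have h1 : H * Q - Q * H = F * (H * D - D * H) - (H * D - D * H) * F - (K * D - D * K) := by
      rw [hQ, hK]; noncomm_ring
    rw [h1, hDE, hG, hS]
    noncomm_ring
  have hcn : ‖H * Q - Q * H‖ ≤ w := by
    rw [hcomm]
    refine (norm_sub_le _ _).trans (add_le_add ((norm_add_le _ _).trans (add_le_add ?_ ?_)) ?_)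
    · exact (norm_comm_le _ _).trans (by gcongr)
    · exact (norm_comm_le _ _).trans (by gcongr)
    · exact (norm_comm_le _ _).trans (by gcongr)
  have hsplit : Q = P * Q * P + N * Q * N + (P * Q * N + N * Q * P) := by
    rw [hN]; noncomm_ring
  have hn : ‖Q‖ ≤ ‖P * Q * P‖ + ‖N * Q * N‖ + (‖P * Q * N‖ + ‖N * Q * P‖) := by
    conv_lhs => rw [hsplit]
    exact (norm_add_le _ _).trans (add_le_add (norm_add_le _ _) (norm_add_le _ _))
  refine hn.trans ?_
  rw [hPQP, hNQN, norm_neg]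
  have hz0 : 0 ≤ z := (norm_nonneg _).trans hZn
  refine add_le_add (add_le_add ?_ ?_) (add_le_add ?_ ?_)
  · exact norm_mul₃_le.trans (by gcongr)
  · exact norm_mul₃_le.trans (by gcongr)
  · exact (hcor Q).1.trans (by gcongr)
  · exact (hcor Q).2.trans (by gcongr)

/-- The commutator `[F, L]` solves a Liouville equation whose source is bounded uniformly in the
height. The factor `1 / η` is harmless, since this is used only at fixed `η` to bring `L` into the
domain of `X_i`. -/
lemma isPosLipschitz_response {H : Op} (hH : IsSelfAdjoint H) {η : ℝ} (hη : 0 < η) {i : Fin 2}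
    (hHi : IsPosLipschitz i H) {D : Op} (hD : IsPosLipschitz i D) :
    IsPosLipschitz i (response H η D) := by
  obtain ⟨C₀, hC₀⟩ := hHi
  obtain ⟨C₁, hC₁⟩ := hD
  set L := response H η D with hL
  refine IsPosLipschitz.of_forall (C := (C₁ + 2 * (C₀ * ‖L‖)) / η) fun n F hF => ?_
  have h1 := norm_le_of_liouvillian hH hη (F * L - L * F)
  have h2 : H * (F * L - L * F) - (F * L - L * F) * H - (Complex.I * η) • (F * L - L * F) =
      (F * D - D * F) - ((F * H - H * F) * L - L * (F * H - H * F)) := by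
    have h3 : D = H * L - L * H - (Complex.I * η) • L := (liouvillian_response hH hη D).symm
    rw [h3]
    simp only [smul_sub, mul_sub, sub_mul, mul_smul_comm, smul_mul_assoc, mul_assoc]
    abel
  rw [h2] at h1
  refine h1.trans ?_
  gcongr
  refine (norm_sub_le _ _).trans (add_le_add (hC₁ n _ (hF D)) ((norm_comm_le _ _).trans ?_))
  have := hC₀ n _ (hF H)
  gcongr

/-! ### The proper spin current -/

/-- Moving `X_i` to the left of `H` isolates the unbounded contribution `i X_i [H, S_z]`, in which
the coordinate is a mere factor at each site. -/
lemma Jprop_apply {H E : Op} {i : Fin 2} (hE : IsKernelComm (pos · i) H E) {ψ : Hil}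
    (hψ : ψ ∈ (X i).domain) : ∃ h : ψ ∈ (Jprop H i).domain, ∀ p,
      Jprop H i ⟨ψ, h⟩ p = Complex.I * (-(E * Sz) ψ p +
        (pos p.1 i : ℂ) * (commOp H Sz) ψ p) := by
  obtain ⟨hS, hSX⟩ := (isKernelComm_Sz (pos · i)).X_apply ⟨ψ, hψ⟩
  obtain ⟨hHS, hHSX⟩ := hE.X_apply ⟨Sz ψ, hS⟩
  obtain ⟨hHψ, -⟩ := hE.X_apply ⟨ψ, hψ⟩
  obtain ⟨hSH, -⟩ := (isKernelComm_Sz (pos · i)).X_apply ⟨H ψ, hHψ⟩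
  have h1 : ψ ∈ (prodU (toU H) (prodU (X i) (toU Sz))).domain :=
    (mem_prodU_domain _ _ _).2
      ⟨(mem_prodU_domain _ _ _).2 ⟨mem_toU_domain _ _, hS⟩, mem_toU_domain _ _⟩
  have h2 : ψ ∈ (prodU (prodU (X i) (toU Sz)) (toU H)).domain :=
    (mem_prodU_domain _ _ _).2
      ⟨mem_toU_domain _ _, (mem_prodU_domain _ _ _).2 ⟨mem_toU_domain _ _, hSH⟩⟩
  refine ⟨⟨h1, h2⟩, fun p => ?_⟩
  have h3 : Jprop H i ⟨ψ, h1, h2⟩ =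
      Complex.I • (H (X i ⟨Sz ψ, hS⟩) - X i ⟨Sz (H ψ), hSH⟩) := rfl
  have h4 : H (X i ⟨Sz ψ, hS⟩) = X i ⟨H (Sz ψ), hHS⟩ - E (Sz ψ) := by
    rw [hHSX]; simp
  rw [h3, h4]
  change Complex.I * (((pos p.1 i : ℂ) * H (Sz ψ) p - E (Sz ψ) p) -
    (pos p.1 i : ℂ) * Sz (H ψ) p) =
    Complex.I * (-(E (Sz ψ) p) + (pos p.1 i : ℂ) * (H (Sz ψ) p - Sz (H ψ) p))
  ring

/-- At the site `x` the unbounded term adds `i x_i` times the spin trace of `[H, S_z] L`. As `x_i`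
grows with the volume, the vanishing is required site by site. -/
lemma hasTracePUV_Jprop {H E L : Op} {i : Fin 2} (hE : IsKernelComm (pos · i) H E)
    (hH : IsPeriodic H) (hL : IsPeriodic L) (hLi : IsPosLipschitz i L)
    (hT : ∀ x, spinTrace (commOp H Sz * L) x = 0) :
    HasTracePUV (prodU (Jprop H i) (toU L)) (cellTrace (Complex.I • (-E * Sz * L))) := by
  obtain ⟨L', hL'⟩ := hLi.exists_isKernelComm
  have hLX : ∀ p, L (delta p) ∈ (X i).domain := fun p => (hL'.X_apply ⟨delta p, delta_mem_X i p⟩).1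
  have hd : ∀ p, delta p ∈ (prodU (Jprop H i) (toU L)).domain := fun p =>
    (mem_prodU_domain _ _ _).2 ⟨mem_toU_domain _ _, (Jprop_apply hE (hLX p)).1⟩
  have hper : Complex.I • (-E * Sz * L) ∈ periodicOps :=
    Subalgebra.smul_mem _ (mul_mem (mul_mem (neg_mem (mem_periodicOps.2 (hE.isPeriodic hH)))
      (mem_periodicOps.2 Sz_isPeriodic)) (mem_periodicOps.2 hL)) _
  refine hasTracePUV_of_sum_spin (mem_periodicOps.1 hper) hd fun x => ?_
  have h1 : ∀ s, inner ℂ (delta (x, s)) (prodU (Jprop H i) (toU L) ⟨delta (x, s), hd _⟩) =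
      (Complex.I • (-E * Sz * L)) (delta (x, s)) (x, s) +
        Complex.I * (pos x i : ℂ) * (commOp H Sz * L) (delta (x, s)) (x, s) := by
    intro s
    obtain ⟨h2, h3⟩ := Jprop_apply hE (hLX (x, s))
    rw [inner_delta_left]
    have h4 : prodU (Jprop H i) (toU L) ⟨delta (x, s), hd _⟩ = Jprop H i ⟨L (delta (x, s)), h2⟩ :=
      rfl
    rw [h4, h3]
    have h5 : (Complex.I • (-E * Sz * L)) (delta (x, s)) (x, s) =
        Complex.I * -((E * Sz) (L (delta (x, s))) (x, s)) := by
      rw [neg_mul, neg_mul]; rfl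
    rw [h5, mul_entry (commOp H Sz) L]
    ring
  simp only [h1]
  rw [Finset.sum_add_distrib, ← Finset.mul_sum]
  have := hT x
  rw [spinTrace] at this
  rw [this]
  simp

/-! ### Periodicity and rotation covariance of the linear response -/

lemma response_isPeriodic {H D : Op} (hH : IsSelfAdjoint H) {η : ℝ} (hη : 0 < η)
    (hHp : IsPeriodic H) (hD : IsPeriodic D) : IsPeriodic (response H η D) := fun n => by
  rw [← response_mul_left hH hη (hHp n), ← response_mul_right hH hη (hHp n), hD n]

lemma response_mul_rotation {H : Op} (hH : IsSelfAdjoint H) {η : ℝ} (hη : 0 < η)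
    (hr : H * rotation = rotation * H) {D : Fin 2 → Op}
    (hD : ∀ j, D j * rotation = rotation * ∑ k, (rotCoeff j k : ℂ) • D k) (j : Fin 2) :
    response H η (D j) * rotation =
      rotation * ∑ k, (rotCoeff j k : ℂ) • response H η (D k) := by
  rw [← response_mul_right hH hη hr, hD, response_mul_left hH hη hr, Fin.sum_univ_two,
    Fin.sum_univ_two, response_add hH hη, response_smul, response_smul]

/-- Symmetrizing `i C S_z` adds `(i/2) [S_z, C]`. This commutator and `L` are self-adjoint, so by
cyclicity their product has real trace, and the added term contributes nothing to the real part. -/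
lemma re_cellTrace_conv_eq {C L : Op} (hC : IsPeriodic C) (hL : IsPeriodic L)
    (hCs : star C = -C) (hLs : IsSelfAdjoint L) :
    (cellTrace (((Complex.I / 2) • (C * Sz) + (Complex.I / 2) • (Sz * C)) * L)).re =
      (cellTrace (Complex.I • (C * Sz * L))).re := by
  set W := Sz * C - C * Sz with hW
  have hWs : star W = W := by
    rw [hW, star_sub, star_mul, star_mul, hCs, Sz_isSelfAdjoint.star_eq]
    noncomm_ring
  have hWp : IsPeriodic W := mem_periodicOps.1 (sub_mem
    (mul_mem (mem_periodicOps.2 Sz_isPeriodic) (mem_periodicOps.2 hC))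
    (mul_mem (mem_periodicOps.2 hC) (mem_periodicOps.2 Sz_isPeriodic)))
  have hreal : star (cellTrace (W * L)) = cellTrace (W * L) := by
    rw [← cellTrace_star, star_mul, hWs, hLs.star_eq, cellTrace_mul_comm hL hWp]
  have hdec : ((Complex.I / 2) • (C * Sz) + (Complex.I / 2) • (Sz * C)) * L =
      Complex.I • (C * Sz * L) + (Complex.I / 2) • (W * L) := by
    rw [hW, sub_mul, smul_sub, add_mul, smul_mul_assoc, smul_mul_assoc]
    have : Complex.I = Complex.I / 2 + Complex.I / 2 := by ring
    conv_rhs => rw [show Complex.I • (C * Sz * L) =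
      (Complex.I / 2) • (C * Sz * L) + (Complex.I / 2) • (C * Sz * L) by rw [← add_smul, ← this]]
    abel
  rw [hdec, map_add, cellTrace.map_smul (Complex.I / 2), Complex.add_re, smul_eq_mul]
  have him : (cellTrace (W * L)).im = 0 := Complex.conj_eq_iff_im.1 hreal
  have : (Complex.I / 2 * cellTrace (W * L)).re = 0 := by
    simp [Complex.mul_re, him]
  rw [this, add_zero]

end

end SpinHall

/-! ### Proof of the proposition -/

theorem proposition3p7 (H : Op) (μ : ℝ) (hins : IsInsulator H μ)
    (hsr : IsShortRange H) (hAII : IsAIIHex H) (i j : Fin 2) :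
    -- every commutator with a position operator below extends to a bounded operator,
    -- and the limit defining `P₁` exists and is periodic
    (IsBoundedExtension
        (commU (toU H) (X i)) (commAX H i) ∧
      (∀ l : Fin 2, IsBoundedExtension
        (commU (X l) (toU (fermiProj H μ)))
        (commXA l (fermiProj H μ))) ∧
      IsBoundedExtension
        (commU (toU (commOp (fermiProj H μ) Sz))
          (X j))
        (commAX (commOp (fermiProj H μ) Sz) j) ∧
      Tendsto (linResponse H μ j) (𝓝[>] 0) (𝓝 (P1 H μ j)) ∧
      IsPeriodic (P1 H μ j)) ∧
    -- the traces per unit volume in `Σ^sc` and `Σ^snc` are well-defined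
    (TracePUVExists (toU (scOp H μ i j)) ∧
      TracePUVExists (toU (sncOp H μ i j))) ∧
    -- the spin conductivities are well-defined, are equal, and split
    ∃ σ : ℝ,
      IsSpinConductivity (Jconv H i) H μ j σ ∧
      IsSpinConductivity (Jprop H i) H μ j σ ∧
      σ = sigmaSC H μ i j + sigmaSNC H μ i j ∧
      (commOp H Sz = 0 → σ = sigmaSC H μ i j) := by
  obtain ⟨hH, hμ⟩ := hins
  obtain ⟨Ck, ξ, hCk, hξ, hdec⟩ := hsr.hasDecay
  have hHp := hAII.periodic
  have hHl : ∀ l, IsPosLipschitz l H := hdec.isPosLipschitz hCk.le hξ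
  choose E hE using fun l => (hHl l).exists_isKernelComm
  set P := fermiProj H μ with hPdef
  have hPlow : lowerProj H μ = P := rfl
  have hPP : P * P = P := lowerProj_mul_self hH hμ
  have hPH : P * H = H * P := (lowerProj_comm H μ).eq
  have hPs : star P = P := lowerProj_isSelfAdjoint H μ
  have hPcomm : ∀ {B : Op}, H * B = B * H → P * B = B * P := fun h =>
    (Commute.lowerProj (show Commute H _ from h) μ).eq
  have hPp : IsPeriodic P := fun n => hPcomm (hHp n)
  choose D hD using fun l => (isPosLipschitz_lowerProj hH hμ (hHl l)).exists_isKernelComm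
  rw [hPlow] at hD
  -- Leibniz rule for `P² = P`; the next identity is the Leibniz rule for `P H = H P`.
  have hDoff : ∀ l, D l * P + P * D l = D l := fun l =>
    IsKernelComm.unique (f := (pos · l)) (A := P * P) ((hD l).mul (hD l)) (hPP.symm ▸ hD l)
  have hDE : ∀ l, H * D l - D l * H = P * E l - E l * P := fun l => by
    have h1 : E l * P + H * D l = D l * H + P * E l :=
      IsKernelComm.unique ((hE l).mul (hD l)) (hPH ▸ (hD l).mul (hE l))
    rw [sub_eq_sub_iff_add_eq_add, add_comm, h1, add_comm]
  have hEs : star (E i) = -E i := by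
    have := (hE i).star
    rw [hH.star_eq] at this
    rw [← neg_inj, neg_neg, this.unique (hE i)]
  have hDs : ∀ l, star (D l) = -D l := fun l => by
    have := (hD l).star
    rw [hPs] at this
    rw [← neg_inj, neg_neg, this.unique (hD l)]
  have hEp : IsPeriodic (E i) := (hE i).isPeriodic hHp
  have hDp : ∀ l, IsPeriodic (D l) := fun l => (hD l).isPeriodic hPp
  have hDl : IsPosLipschitz i (D j) := by
    refine isPosLipschitz_comm_lowerProj hH hμ (hHl i) (hDoff j) (hDE j) ?_
    exact (hdec.of_isKernelComm hCk.le hξ (fun _ _ => le_rfl) (hE j)).isPosLipschitz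
      (by positivity) (by positivity) i
  have hXP : ∀ l, commXA l P = D l := fun l => (hD l).commXA_eq
  have hHX : commAX H i = -E i := (hE i).commAX_eq
  have hPS : IsKernelComm (pos · j) (commOp P Sz) (D j * Sz - Sz * D j) := by
    have h := ((hD j).mul (isKernelComm_Sz (pos · j))).sub
      ((isKernelComm_Sz (pos · j)).mul (hD j))
    simpa [commOp] using h
  have hPSX : commAX (commOp P Sz) j = Sz * D j - D j * Sz := by
    rw [hPS.commAX_eq, neg_sub]
  have hlin : ∀ l, linResponse H μ l = fun η => response H η (D l) := fun l => by
    rw [← hXP l]; rfl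
  obtain ⟨L, hL⟩ := exists_tendsto_response hH hμ (hDoff j)
  have hP1 : P1 H μ j = L := by
    rw [P1, hlin j]; exact hL.limUnder_eq
  have hRp : ∀ l η, 0 < η → IsPeriodic (response H η (D l)) := fun l η hη =>
    response_isPeriodic hH hη hHp (hDp l)
  have hpos : ∀ᶠ η : ℝ in 𝓝[>] 0, 0 < η := self_mem_nhdsWithin
  have hLp : IsPeriodic L := mem_periodicOps.1 (isClosed_periodicOps.mem_of_tendsto hL
    (hpos.mono fun η hη => mem_periodicOps.2 (hRp j η hη)))
  have hLoff : L * P + P * L = L := by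
    refine tendsto_nhds_unique ((hL.mul_const P).add (hL.const_mul P)) (hL.congr' ?_)
    exact hpos.mono fun η hη => (response_offDiag hH hη hPH.symm (hDoff j)).symm
  -- The Liouville equation survives the limit without its term `i η L_η`, since the responses stay
  -- bounded.
  have hLD : H * L - L * H = D j := by
    have h1 : Tendsto (fun η : ℝ => (Complex.I * (η : ℂ)) • response H η (D j)) (𝓝[>] 0)
        (𝓝 0) := by
      have h2 : Tendsto (fun η : ℝ => Complex.I * (η : ℂ)) (𝓝[>] 0) (𝓝 0) := by
        have h3 : Continuous fun η : ℝ => Complex.I * (η : ℂ) := by fun_prop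
        simpa using (h3.tendsto 0).mono_left nhdsWithin_le_nhds
      simpa using h2.smul hL
    have h2 := ((hL.const_mul H).sub (hL.mul_const H)).sub h1
    rw [sub_zero] at h2
    refine tendsto_nhds_unique h2 (tendsto_const_nhds.congr' ?_)
    exact hpos.mono fun η hη => (liouvillian_response hH hη (D j)).symm
  have hrot : ∀ l, D l * SpinHall.rotation = SpinHall.rotation * ∑ k, (rotCoeff l k : ℂ) • D k :=
    kernelComm_mul_spinOp hD (hPcomm hAII.rotation_symm) pos_rotSite_sub
  -- `[H, S_z]` commutes with the rotation, so its product with the response inherits the vector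
  -- behaviour of `[X_l, P]`.
  have hT : ∀ η, 0 < η → ∀ x, spinTrace (commOp H Sz * response H η (D j)) x = 0 := by
    intro η hη
    have hcH : Commute H SpinHall.rotation := hAII.rotation_symm
    have hcS : Commute Sz SpinHall.rotation := Sz_commute_rotation
    have hTrot : commOp H Sz * SpinHall.rotation = SpinHall.rotation * commOp H Sz :=
      ((hcH.mul_left hcS).sub_left (hcS.mul_left hcH)).eq
    refine spinTrace_eq_zero_of_rotation (A := fun l => commOp H Sz * response H η (D l))
      (fun l => mem_periodicOps.1 (mul_mem (sub_mem
        (mul_mem (mem_periodicOps.2 hHp) (mem_periodicOps.2 Sz_isPeriodic))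
        (mul_mem (mem_periodicOps.2 Sz_isPeriodic) (mem_periodicOps.2 hHp)))
        (mem_periodicOps.2 (hRp l η hη)))) (fun l => ?_) j
    rw [mul_assoc, response_mul_rotation hH hη hAII.rotation_symm hrot, ← mul_assoc, hTrot,
      mul_assoc, Finset.mul_sum]
    simp only [mul_smul_comm]
  set C := -E i with hC
  have mH := mem_periodicOps.2 hHp
  have mP := mem_periodicOps.2 hPp
  have mS := mem_periodicOps.2 Sz_isPeriodic
  have mC : C ∈ periodicOps := neg_mem (mem_periodicOps.2 hEp)
  have mL := mem_periodicOps.2 hLp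
  have mi := mem_periodicOps.2 (hDp i)
  have mj := mem_periodicOps.2 (hDp j)
  have hCs : star C = -C := by rw [hC, star_neg, hEs]
  have hconv : ∀ η, 0 < η → HasTracePUV (prodU (Jconv H i) (toU (linResponse H μ j η)))
      (cellTrace (((Complex.I / 2) • (C * Sz) + (Complex.I / 2) • (Sz * C)) *
        response H η (D j))) := fun η hη => by
    rw [Jconv, hHX, hlin]
    refine IsPeriodic.hasTracePUV_prodU (mem_periodicOps.1 (mul_mem (add_mem
      (Subalgebra.smul_mem _ (mul_mem mC mS) _) (Subalgebra.smul_mem _ (mul_mem mS mC) _))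
      (mem_periodicOps.2 (hRp j η hη))))
  have hprop : ∀ η, 0 < η → HasTracePUV (prodU (Jprop H i) (toU (linResponse H μ j η)))
      (cellTrace (Complex.I • (C * Sz * response H η (D j)))) := fun η hη => by
    rw [hlin]
    exact hasTracePUV_Jprop (hE i) hHp (hRp j η hη)
      (isPosLipschitz_response hH hη (hHl i) hDl) (hT η hη)
  have hlim : Tendsto (fun η => (cellTrace (Complex.I • (C * Sz * response H η (D j)))).re)
      (𝓝[>] 0) (𝓝 (cellTrace (Complex.I • (C * Sz * L))).re) :=
    (Complex.continuous_re.tendsto _).comp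
      (tendsto_cellTrace ((hL.const_mul (C * Sz)).const_smul Complex.I))
  have hsc : scOp H μ i j = Complex.I • (Sz * P * (D i * D j - D j * D i)) := by
    rw [scOp, ← hPdef, hXP, hXP]; rfl
  set snc : Op := C * ((Sz * P - P * Sz) * P - P * (Sz * P - P * Sz)) * L +
    (D i * P - P * D i) * (Sz * H - H * Sz) * L + P * D i * (Sz * D j - D j * Sz) with hsncdef
  have hsnc : sncOp H μ i j = Complex.I • snc := by
    rw [sncOp, ← hPdef, hXP, hHX, hPSX, hP1, hsncdef, smul_add, smul_add]; rfl
  have hscT : HasTracePUV (toU (scOp H μ i j))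
      (cellTrace (Complex.I • (Sz * P * (D i * D j - D j * D i)))) := by
    rw [hsc]
    exact IsPeriodic.hasTracePUV (mem_periodicOps.1 (Subalgebra.smul_mem _ (mul_mem
      (mul_mem mS mP) (sub_mem (mul_mem mi mj) (mul_mem mj mi))) _))
  have hsncT : HasTracePUV (toU (sncOp H μ i j)) (cellTrace (Complex.I • snc)) := by
    rw [hsnc]
    have mSP := sub_mem (mul_mem mS mP) (mul_mem mP mS)
    exact IsPeriodic.hasTracePUV (mem_periodicOps.1 (Subalgebra.smul_mem _ (add_mem (add_mem
      (mul_mem (mul_mem mC (sub_mem (mul_mem mSP mP) (mul_mem mP mSP))) mL)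
      (mul_mem (mul_mem (sub_mem (mul_mem mi mP) (mul_mem mP mi))
        (sub_mem (mul_mem mS mH) (mul_mem mH mS))) mL))
      (mul_mem (mul_mem mP mi) (sub_mem (mul_mem mS mj) (mul_mem mj mS)))) _))
  have hdecomp : cellTrace (C * Sz * L) =
      cellTrace (Sz * P * (D i * D j - D j * D i)) + cellTrace snc := by
    -- The functional is cyclic on periodic operators, so the identity is applied inside that
    -- subalgebra.
    let τ : periodicOps →+ ℂ := (cellTrace.toAddMonoidHom).comp
      (periodicOps.toSubring.subtype.toAddMonoidHom)
    have hτ : ∀ x y : periodicOps, τ (x * y) = τ (y * x) := fun x y =>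
      cellTrace_mul_comm (mem_periodicOps.1 x.2) (mem_periodicOps.1 y.2)
    have hca : C * P - P * C = H * D i - D i * H := by
      rw [hDE, hC]; noncomm_ring
    exact tracial_decomposition (P := (⟨P, mP⟩ : periodicOps)) hτ (Subtype.ext hPP)
      (h := ⟨H, mH⟩) (s := ⟨Sz, mS⟩) (c := ⟨C, mC⟩) (a := ⟨D i, mi⟩) (b := ⟨D j, mj⟩)
      (l := ⟨L, mL⟩) (Subtype.ext hPH.symm) (Subtype.ext (hDoff i)) (Subtype.ext (hDoff j))
      (Subtype.ext hLoff) (Subtype.ext hLD) (Subtype.ext hca)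
  have hσ : (cellTrace (Complex.I • (C * Sz * L))).re =
      sigmaSC H μ i j + sigmaSNC H μ i j := by
    rw [sigmaSC, sigmaSNC, hscT.tau_eq, hsncT.tau_eq, map_smul, hdecomp, smul_add,
      ← map_smul, ← map_smul, Complex.add_re]
  refine ⟨⟨?_, fun l => ?_, ?_, ?_, ?_⟩, ⟨hscT.exists, hsncT.exists⟩,
    (cellTrace (Complex.I • (C * Sz * L))).re, ⟨fun η hη => (hconv η hη).exists, ?_⟩,
    ⟨fun η hη => (hprop η hη).exists, ?_⟩, hσ, fun h0 => ?_⟩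
  · rw [hHX]; exact (hE i).isBoundedExtension_neg
  · rw [hXP]; exact (hD l).isBoundedExtension
  · rw [hPS.commAX_eq]; exact hPS.isBoundedExtension_neg
  · rw [hP1, hlin]; exact hL
  · rw [hP1]; exact hLp
  · refine hlim.congr' (hpos.mono fun η hη => ?_)
    dsimp only
    rw [(hconv η hη).tau_eq]
    exact (re_cellTrace_conv_eq (mem_periodicOps.1 mC) (hRp j η hη) hCs
      (response_isSelfAdjoint hH hη (hDs j))).symm
  · refine hlim.congr' (hpos.mono fun η hη => ?_)
    dsimp only
    rw [(hprop η hη).tau_eq]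
  · have hHS : H * Sz = Sz * H := sub_eq_zero.1 h0
    -- If `H` commutes with `S_z`, so does `P`, and then `[X_j, P]` as well; each of the three terms
    -- contains one of these commutators.
    have hsnc0 : snc = 0 := by
      have h1 := hPcomm hHS
      have hDS : D j * Sz - Sz * D j = 0 := by
        refine hPS.unique fun p q => ?_
        rw [commOp, h1, sub_self]
        simp
      rw [hsncdef, ← h1, hHS, ← neg_sub (D j * Sz), hDS]
      simp
    rw [hσ, sigmaSNC, hsncT.tau_eq, hsnc0]
    simp
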